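/- Let $\mathfrak g$ be a finite-dimensional semisimple Lie algebra over a field $K$ of characteristic $0$, with splitting Cartan subalgebra $\mathfrak h$, roots $\Sigma$, Weyl group $W$, and a base $\Delta$ of simple roots. Fix a frame, i.e. a nonzero vector $e_\alpha\in\mathfrak g_\alpha$ for each $\alpha\in\Delta$. For a nonzero root vector $x\in\mathfrak g_\alpha$ let $x_-\in\mathfrak g_{-\alpha}$ be the vector with $[x,x_-]=-\alpha^\vee$, and let $n(x)=\exp(x)\exp(x_-)\exp(x)$ be Tits' element of the normalizer of the torus; put $s_\alpha^\bullet=n(e_\alpha)$ for $\alpha\in\Delta$. For $w\in W$ let $w^\bullet=s_{\alpha_1}^\bullet\cdots s_{\alpha_r}^\bullet$, where $w=s_{\alpha_1}\cdots s_{\alpha_r}$ is a reduced expression. For roots $\beta,\gamma$ put $\langle\!\langle\beta,\gamma\rangle\!\rangle=\langle\beta,\gamma^\vee\rangle$ if this is positive; $\langle\!\langle\beta,\gamma\rangle\!\rangle=p_{\gamma,\beta}$, the largest $p$ such that $\beta-p\gamma$ is a root, if $\langle\beta,\gamma^\vee\rangle=0$; and $\langle\!\langle\beta,\gamma\rangle\!\rangle=0$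 otherwise. Let $F(w,\beta)=\sum_{\gamma>0,\,w\gamma<0}\langle\!\langle\beta,\gamma\rangle\!\rangle$, and let $w^\triangle$ act on $\mathfrak g_\beta$ by $w^\triangle v=(-1)^{F(w,\beta)}\,\mathrm{Ad}(w^\bullet)v$. Call the set of all simple roots of a given length in a given connected component of the Dynkin diagram a segment, and choose one special simple root $\alpha_\Xi$ in each segment $\Xi$. Define $\mathfrak k_{\alpha_\Xi}=e_{\alpha_\Xi}$ and, if $\lambda=w\alpha_\Xi$ with $w\in W$, $\mathfrak k_\lambda=w^\triangle e_{\alpha_\Xi}$. For $\alpha\in\Delta$ let $\sigma_\alpha=n(\mathfrak k_\alpha)$, let $d(\alpha)$ be the distance in the Dynkin diagram from $\alpha$ to the special root in its segment, and let $c_\alpha=(-1)^{d(\alpha)}$. Then the vectors $\mathfrak k_\lambda$ are well defined for all $\lambda\in\Sigma$ (each root is of the form $w\alpha_\Xi$, and $w^\triangle e_{\alpha_\Xi}$ depends only on the root $w\alpha_\Xi$), and for every $\alpha\in\Delta$ $$\mathfrak k_\alpha=c_\alpha\,e_\alpha,\qquad \sigma_\alpha=\alpha^\vee(c_\alpha)\,s_\alpha^\bullet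 .$$ The second equality is an equality of operators in every finite-dimensional representation of $\mathfrak g$, where $\alpha^\vee(c)$ acts by $c^{n}$ on the eigenspace of $\alpha^\vee\in\mathfrak h$ with eigenvalue $n\in\mathbb Z$. -/

import Mathlib

noncomputable section

namespace Kottwitz

open Module LieAlgebra LieAlgebra.IsKilling LieModule

/-! ### Combinatorics of a root system with a chosen base -/

section RootSystem

variable {ι R M N : Type*} [Fintype ι] [Field R] [CharZero R]
  [AddCommGroup M] [Module R M] [AddCommGroup N] [Module R N]
  {P : RootPairing ι R M N} [P.IsCrystallographic]

/-- Kottwitz' integer `⟪β, γ⟫`: it is `⟨β, γ^∨⟩` if this is positive, `p_{γ,β}` if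
`⟨β, γ^∨⟩ = 0`, and `0` otherwise.  Here `p_{γ,β}` is the largest `p` such that `β - p γ` is a
root. -/
def term (P : RootPairing ι R M N) [P.IsCrystallographic] (β γ : ι) : ℤ :=
  if 0 < P.pairingIn ℤ β γ then P.pairingIn ℤ β γ
  else if P.pairingIn ℤ β γ = 0 then (P.chainBotCoeff γ β : ℤ)
  else 0

open Classical in
/-- `R_w`: the positive roots made negative by `w`. -/
def inversions (b : P.Base) (w : P.weylGroup) : Finset ι :=
  {γ | b.IsPos γ ∧ ¬ b.IsPos (P.weylGroupToPerm w γ)}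

/-- `F(w, β) = ∑_{γ ∈ R_w} ⟪β, γ⟫`. -/
def kottwitzExponent (b : P.Base) (w : P.weylGroup) (β : ι) : ℤ :=
  ∑ γ ∈ inversions b w, term P β γ

/-- The Dynkin diagram (as a simple graph, forgetting multiplicities of bonds): two distinct simple
roots are joined if and only if they are not orthogonal. -/
def dynkin (b : P.Base) : SimpleGraph b.support where
  Adj i j := i ≠ j ∧ P.pairing i j ≠ 0
  symm := ⟨fun _ _ h => ⟨h.1.symm, fun h0 => h.2 (P.pairing_eq_zero_iff.mp h0)⟩⟩
  loopless := ⟨fun _ h => h.1 rfl⟩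

/-- Two simple roots lie in the same segment of the Dynkin diagram if they belong to the same
connected component (i.e. to the same irreducible factor of the root system) and have the same
length. -/
def SameSegment (b : P.Base) (i j : b.support) : Prop :=
  (dynkin b).Reachable i j ∧
    P.RootForm (P.root i) (P.root i) = P.RootForm (P.root j) (P.root j)

/-- A choice of one special simple root in each segment; `sp i` is the special root in the segment
of `i`. -/
structure IsSpecialChoice (b : P.Base) (sp : b.support → b.support) : Prop where
  sameSegment (i : b.support) : SameSegment b i (sp i)
  eq_of_sameSegment (i j : b.support) : SameSegment b i j → sp i = sp j

/-- The product of simple reflections described by a word. -/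
def wordProd (b : P.Base) (l : List b.support) : P.weylGroup :=
  (l.map fun i : b.support => RootPairing.weylGroup.ofIdx P i.1).prod

/-- The simple reflections generate the Weyl group. -/
theorem exists_word [P.IsReduced] (b : P.Base) (w : P.weylGroup) :
    ∃ l : List b.support, wordProd b l = w := by
  have conj (i j : ι) : RootPairing.weylGroup.ofIdx P (P.reflectionPerm j i) =
      RootPairing.weylGroup.ofIdx P j * RootPairing.weylGroup.ofIdx P i *
        RootPairing.weylGroup.ofIdx P j := by
    apply Subtype.ext
    apply RootPairing.Equiv.weightHom_injective P
    ext x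
    change P.reflection (P.reflectionPerm j i) x = P.reflection j (P.reflection i (P.reflection j x))
    rw [P.reflection_reflectionPerm]
    rfl
  have key (i : ι) : ∃ l : List b.support, wordProd b l = RootPairing.weylGroup.ofIdx P i := by
    refine b.induction_reflect i (p := fun i => ∃ l : List b.support,
      wordProd b l = RootPairing.weylGroup.ofIdx P i) ?_ ?_ ?_
    · rintro i ⟨l, hl⟩
      exact ⟨l ++ (l ++ l), by simp only [conj, ← hl, wordProd, List.map_append, List.prod_append,
        mul_assoc]⟩
    · intro i hi
      exact ⟨[⟨i, hi⟩], by simp [wordProd]⟩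
    · rintro i j ⟨l, hl⟩ hj
      exact ⟨⟨j, hj⟩ :: (l ++ [⟨j, hj⟩]), by
        simp only [conj, ← hl, wordProd, List.map_append, List.prod_append, List.map_cons,
          List.prod_cons, List.map_nil, List.prod_nil, mul_one, mul_assoc]⟩
  obtain ⟨w, hw⟩ := w
  induction hw using RootPairing.weylGroup.induction with
  | mem i => exact key i
  | one => exact ⟨[], rfl⟩
  | mul x y hx hy ihx ihy =>
    obtain ⟨l, hl⟩ := ihx
    obtain ⟨m, hm⟩ := ihy
    refine ⟨l ++ m, ?_⟩
    have : wordProd b (l ++ m) = wordProd b l * wordProd b m := by simp [wordProd]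
    rw [this, hl, hm]; rfl

theorem exists_reducedWord [P.IsReduced] (b : P.Base) (w : P.weylGroup) :
    ∃ l : List b.support, wordProd b l = w ∧
      ∀ l' : List b.support, wordProd b l' = w → l.length ≤ l'.length := by
  classical
  have h : ∃ n, ∃ l : List b.support, l.length = n ∧ wordProd b l = w := by
    obtain ⟨l, hl⟩ := exists_word b w
    exact ⟨_, l, rfl, hl⟩
  obtain ⟨l, hl, hw⟩ := Nat.find_spec h
  exact ⟨l, hw, fun l' hl' => hl ▸ Nat.find_min' h ⟨l', rfl, hl'⟩⟩

/-- A reduced expression of `w`, i.e. a word in the simple reflections of minimal length. -/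
def reducedWord [P.IsReduced] (b : P.Base) (w : P.weylGroup) : List b.support :=
  (exists_reducedWord b w).choose

end RootSystem

/-! ### Tits' elements, the torus, and Kottwitz' splitting -/

section LieAlgebra

variable {K L : Type*} [Field K] [CharZero K] [LieRing L] [LieAlgebra K L]
  [FiniteDimensional K L] [LieAlgebra.IsKilling K L]
  {H : LieSubalgebra K L} [H.IsCartanSubalgebra] [IsTriangularizable K H L]

/-- For a nonzero root vector `x ∈ 𝔤_α` there is exactly one `y ∈ 𝔤_{-α}` with
`[x, y] = -α^∨`. -/
theorem existsUnique_opposite (α : H.root) (x : L) (hx : x ∈ rootSpace H α.1) (hx0 : x ≠ 0) :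
    ∃! y : L, y ∈ rootSpace H (-α.1) ∧ ⁅x, y⁆ = -(coroot α.1 : L) := by
  have hα : α.1.IsNonZero := H.isNonZero_coe_root α
  obtain ⟨h, e, f, ht, heα, hfα⟩ := exists_isSl2Triple_of_weight_isNonZero hα
  have hh : h = coroot α.1 := ht.h_eq_coroot hα heα hfα
  have hc0 : (coroot α.1 : L) ≠ 0 := hh ▸ ht.h_ne_zero
  obtain ⟨c, hc⟩ := (finrank_eq_one_iff_of_nonzero' (⟨e, heα⟩ : rootSpace H α.1)
    (fun h0 => ht.e_ne_zero (congrArg Subtype.val h0))).mp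
    (finrank_rootSpace_eq_one α.1 hα) ⟨x, hx⟩
  have hc' : c • e = x := congrArg Subtype.val hc
  have hcne : c ≠ 0 := by rintro rfl; exact hx0 (by rw [← hc', zero_smul])
  have hxf : ⁅x, f⁆ = c • (coroot α.1 : L) := by rw [← hc', smul_lie, ht.lie_e_f, hh]
  have hneg : (-α.1).IsNonZero := hα.neg
  refine ⟨-(c⁻¹ • f), ⟨neg_mem (Submodule.smul_mem _ _ hfα), ?_⟩, ?_⟩
  · rw [lie_neg, lie_smul, hxf, smul_smul, inv_mul_cancel₀ hcne, one_smul]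
  · rintro y ⟨hy, hxy⟩
    obtain ⟨d, hd⟩ := (finrank_eq_one_iff_of_nonzero' (⟨f, hfα⟩ : rootSpace H (-α.1))
      (fun h0 => ht.f_ne_zero (congrArg Subtype.val h0))).mp
      (finrank_rootSpace_eq_one (-α.1) hneg) ⟨y, hy⟩
    have hd' : d • f = y := congrArg Subtype.val hd
    rw [← hd', lie_smul, hxf, smul_smul, ← neg_one_smul K (coroot α.1 : L)] at hxy
    have hdc : d * c = -1 := smul_left_injective K hc0 hxy
    rw [← hd', ← neg_smul]
    congr 1
    field_simp
    exact hdc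

open Classical in
/-- The element `x_- ∈ 𝔤_{-α}` opposite to the nonzero root vector `x ∈ 𝔤_α`, in Tits'
normalization `[x, x_-] = -α^∨`. -/
def opposite (α : H.root) (x : L) : L :=
  if h : ∃ y : L, y ∈ rootSpace H (-α.1) ∧ ⁅x, y⁆ = -(coroot α.1 : L) then h.choose else 0

section Module

variable (V : Type*) [AddCommGroup V] [Module K V] [LieRingModule L V] [LieModule K L V]

/-- The exponential of (the nilpotent action of) an element of `𝔤` on a finite-dimensional
representation `V`. -/
def expOn (K : Type*) {L : Type*} [Field K] [CharZero K] [LieRing L] [LieAlgebra K L]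
    (V : Type*) [AddCommGroup V] [Module K V] [LieRingModule L V] [LieModule K L V] (x : L) :
    Module.End K V :=
  letI : Module ℚ (Module.End K V) := Module.compHom _ (algebraMap ℚ K)
  IsNilpotent.exp (toEnd K L V x)

/-- The action on the representation `V` of the element `exp(x) exp(x_-) exp(x)` of the normalizer
of the torus which Tits associates to a nonzero root vector `x ∈ 𝔤_α`. -/
def titsElement (α : H.root) (x : L) : Module.End K V :=
  expOn K V x * expOn K V (opposite α x) * expOn K V x

open Classical in
/-- The action on the representation `V` of the element `α^∨(c)` of the torus: the unique
linear map which is multiplication by `c ^ n` on the eigenspace of the coroot `α^∨ ∈ 𝔥` for the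
integer `n` (i.e. on the sum of the weight spaces `V_μ` with `⟨μ, α^∨⟩ = n`). -/
def corootElement (α : H.root) (c : Kˣ) : Module.End K V :=
  if h : ∃! T : Module.End K V, ∀ (n : ℤ) (v : V), ⁅(coroot α.1 : L), v⁆ = (n : K) • v →
      T v = ((c ^ n : Kˣ) : K) • v
  then h.choose else 0

/-- The action on `V` of Tits' representative of `w` in the normalizer of the torus, with
respect to the frame `e`: the product of Tits' elements of the simple root vectors along
a reduced expression of `w`. -/
def titsLift (b : (rootSystem H).Base) (e : ∀ i : b.support, rootSpace H i.1.1)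
    (w : (rootSystem H).weylGroup) : Module.End K V :=
  ((reducedWord b w).map fun i : b.support => titsElement V i.1 (e i : L)).prod

end Module

/-- The sign `τ_w(β) = (-1)^{F(w, β)}`. -/
def tau (b : (rootSystem H).Base) (w : (rootSystem H).weylGroup) (β : H.root) : Kˣ :=
  (-1) ^ kottwitzExponent b w β

/-- The action of Kottwitz' lift, the product of Tits' lift and `τ_w`, on the root space `𝔤_β`
(Tits' lift acts by the adjoint representation, `τ_w` by the scalar `τ_w(β)`). -/
def kottwitzLift (b : (rootSystem H).Base) (e : ∀ i : b.support, rootSpace H i.1.1)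
    (w : (rootSystem H).weylGroup) (β : H.root) : rootSpace H β.1 →ₗ[K] L :=
  titsLift L b e w ∘ₗ (((tau b w β : Kˣ) : K) • (rootSpace H β.1).toSubmodule.subtype)

/-- The defining property of Kottwitz' root vectors `k_λ`, given a frame and a choice of special
roots: `k_α = e_α` for `α` special, and if `λ = w α` with `α` special then
`k_λ` is the image of `e_α` under Kottwitz' lift of `w`. -/
structure IsKottwitzFamily (b : (rootSystem H).Base) (e : ∀ i : b.support, rootSpace H i.1.1)
    (sp : b.support → b.support) (k : H.root → L) : Prop where
  special (i : b.support) : k (sp i) = e (sp i)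
  lift (w : (rootSystem H).weylGroup) (i : b.support) :
    k ((rootSystem H).weylGroupToPerm w (sp i)) = kottwitzLift b e w (sp i) (e (sp i))

/-- `c_α = (-1)^{d(α)}`, where `d(α)` is the distance in the Dynkin diagram from the
simple root `α` to the special root in its segment. -/
def segmentSign (b : (rootSystem H).Base) (sp : b.support → b.support) (i : b.support) : Kˣ :=
  (-1) ^ (dynkin b).dist i (sp i)

end LieAlgebra

end Kottwitz

end

/-! Independence of the choice of `w` is hard to see from the definition of `w^△`. Instead, nonzero
root vectors `k μ` are built without reduced words, subject to `k_μ = s_i^• k_{s_i μ}` whenever `⟨μ,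
α_i^∨⟩ > 0` (`exists_rootVectors`). This is a recursion on the height. It is consistent for the
following reason: if two simple roots `α_i ≠ α_j` both pair positively with `μ`, then either they
are orthogonal and `s_i^•`, `s_j^•` commute, or positive definiteness forces `μ = α_i + α_j` with a
simple bond. In the second case only the `A₂` braid relation on the single root space of `-(α_i +
α_j)` is needed. General braid relations never enter.

It follows that `s_i^• k_μ = (-1)^{⟪μ, α_i⟫} k_{s_i μ}` for all `μ`
(`titsElement_apply_rootVectors`). For a negative pairing this is the defining property. For a
positive one it says that the square of `s_i^•` is `(-1)^n` on the eigenvalue `n` of the coroot. For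
a zero pairing, the `α_i`-string has one or three members, and the middle vector of a
three-dimensional `sl₂`-module changes sign. Since `F` is additive along reduced words
(`kottwitzExponent_cons`), `w^△ k_μ = k_{wμ}`. A Kottwitz family is therefore `k` rescaled by one
constant on each Weyl orbit of roots, and it is well defined because each orbit contains exactly one
special root.

For the signs: across a simple bond, `s_i^• s_j^•` takes `e_i` to `e_j` but `k_i` to `-k_j`, so the
ratio of `k` to `e` alternates along simple bonds. Two bonds between roots of different lengths
cannot be linked by a chain of simple bonds. A shortest Dynkin path between two members of a segment
thus stays in the segment, and the number of sign changes is `d(α)`. The formula for `σ_α` follows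
from `n(-x) = n(x)⁻¹` and `n(x)² = α^∨(-1)`. -/

noncomputable section

namespace Kottwitz

open Module LieAlgebra LieAlgebra.IsKilling LieModule

/-! ### Exponentials of nilpotent operators -/

section Exponential

variable {K L V : Type*} [Field K] [CharZero K] [LieRing L] [LieAlgebra K L]
  [AddCommGroup V] [Module K V] [LieRingModule L V] [LieModule K L V]

/-- In characteristic zero, an element scaled by a nonzero integer under the bracket with some `h`
acts nilpotently on every finite-dimensional representation. -/
theorem isNilpotent_toEnd_of_lie_eq_smul [FiniteDimensional K V] {h x : L} {c : K} (hc : c ≠ 0)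
    (hx : ⁅h, x⁆ = c • x) : IsNilpotent (toEnd K L V x) := by
  by_contra hn
  have hn' (n : ℕ) : toEnd K L V x ^ n ≠ 0 := fun h0 => hn ⟨n, h0⟩
  set a := toEnd K L V x with ha
  set t := toEnd K L V h with ht
  have hta : t * a = a * t + c • a := by
    ext v
    simp [ha, ht, leibniz_lie h, hx, add_comm]
  -- Under the commutator with `h`, each power `a ^ n` is an eigenvector of eigenvalue `n c`. If no
  -- power vanished, this operator on a finite-dimensional space would have infinitely many
  -- eigenvalues.
  let D : End K (End K V) := LinearMap.mulLeft K t - LinearMap.mulRight K t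
  have hD (n : ℕ) : D (a ^ n) = ((n : K) * c) • a ^ n := by
    have key : t * a ^ n = a ^ n * t + ((n : K) * c) • a ^ n := by
      induction n with
      | zero => simp
      | succ n ih =>
        rw [pow_succ, ← mul_assoc, ih, add_mul, mul_assoc, hta, smul_mul_assoc, ← pow_succ, mul_add,
          ← mul_assoc, ← pow_succ, mul_smul_comm, ← pow_succ]
        push_cast
        module
    simp only [D, LinearMap.sub_apply, LinearMap.mulLeft_apply, LinearMap.mulRight_apply, key]
    abel
  have hinj : Function.Injective fun n : ℕ => (n : K) * c := fun m n hmn => by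
    simpa [hc] using hmn
  have aux (μ : Set.range fun n : ℕ => (n : K) * c) :
      D.HasEigenvector μ (a ^ μ.property.choose) := by
    refine ⟨?_, hn' _⟩
    rw [Module.End.mem_eigenspace_iff, hD]
    exact congrArg (· • _) μ.property.choose_spec
  have := (D.eigenvectors_linearIndependent _ _ aux).finite
  exact Set.infinite_range_of_injective hinj (Set.toFinite _)

theorem expOn_eq_sum {x : L} {k : ℕ} (hk : toEnd K L V x ^ k = 0) :
    expOn K V x = ∑ i ∈ Finset.range k, (i.factorial : K)⁻¹ • toEnd K L V x ^ i := by
  let _ : Module ℚ (Module.End K V) := Module.compHom _ (algebraMap ℚ K)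
  have : expOn K V x = ∑ i ∈ Finset.range k, (i.factorial : ℚ)⁻¹ • toEnd K L V x ^ i :=
    IsNilpotent.exp_eq_sum hk
  rw [this]
  refine Finset.sum_congr rfl fun i _ => ?_
  change (algebraMap ℚ K (i.factorial : ℚ)⁻¹) • toEnd K L V x ^ i = _
  simp

theorem expOn_mul_expOn_neg {x : L} (hx : IsNilpotent (toEnd K L V x)) :
    expOn K V x * expOn K V (-x) = 1 := by
  let _ : Module ℚ (Module.End K V) := Module.compHom _ (algebraMap ℚ K)
  have := IsNilpotent.exp_mul_exp_neg_self hx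
  rwa [← map_neg] at this

theorem expOn_neg_mul_expOn {x : L} (hx : IsNilpotent (toEnd K L V x)) :
    expOn K V (-x) * expOn K V x = 1 := by
  let _ : Module ℚ (Module.End K V) := Module.compHom _ (algebraMap ℚ K)
  have := IsNilpotent.exp_neg_mul_exp_self hx
  rwa [← map_neg] at this

theorem expOn_apply_eq_sum {x : L} {v : V} {k : ℕ} (hx : IsNilpotent (toEnd K L V x))
    (hk : (toEnd K L V x ^ k) v = 0) :
    expOn K V x v = ∑ i ∈ Finset.range k, (i.factorial : K)⁻¹ • (toEnd K L V x ^ i) v := by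
  obtain ⟨N, hN⟩ := hx
  have hN' : toEnd K L V x ^ (k + N) = 0 := by rw [pow_add, hN, mul_zero]
  rw [expOn_eq_sum hN', LinearMap.sum_apply, Finset.sum_range_add]
  simp only [LinearMap.smul_apply]
  rw [add_eq_left]
  refine Finset.sum_eq_zero fun i _ => ?_
  rw [add_comm k i, pow_add, Module.End.mul_apply, hk, map_zero, smul_zero]

omit [CharZero K] in
theorem toEnd_mul_eq (x y : L) :
    toEnd K L V x * toEnd K L V y = toEnd K L V y * toEnd K L V x + toEnd K L V ⁅x, y⁆ := by
  ext v
  simp [add_comm]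

/-- Conjugation by an exponential, when the adjoint action is nilpotent of order three. -/
theorem expOn_mul_toEnd {x y z w : L} (hx : IsNilpotent (toEnd K L V x)) (hz : ⁅x, y⁆ = z)
    (hw : ⁅x, z⁆ = w) (h0 : ⁅x, w⁆ = 0) :
    expOn K V x * toEnd K L V y = toEnd K L V (y + z + (2⁻¹ : K) • w) * expOn K V x := by
  obtain ⟨N, hN⟩ := hx
  -- Moving `y` past a divided power of `x` produces terms of degree lower by 0, 1 and 2; three
  -- truncations of the same exponential absorb these shifts.
  have e0 := expOn_eq_sum hN
  have e1 := expOn_eq_sum (x := x) (V := V) (k := N + 1) (by rw [pow_succ, hN, zero_mul])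
  have e2 := expOn_eq_sum (x := x) (V := V) (k := N + 2) (by rw [pow_add, hN, zero_mul])
  set a := toEnd K L V x
  set d : ℕ → End K V := fun n => (n.factorial : K)⁻¹ • a ^ n with hd
  have had (n : ℕ) : a * d n = ((n : K) + 1) • d (n + 1) := by
    have h1 : ((n : K) + 1) ≠ 0 := Nat.cast_add_one_ne_zero n
    rw [hd]
    simp only [mul_smul_comm, ← pow_succ', smul_smul, Nat.factorial_succ]
    congr 1
    push_cast
    have : (n.factorial : K) ≠ 0 := by exact_mod_cast n.factorial_ne_zero
    field_simp
  have hy : a * toEnd K L V y = toEnd K L V y * a + toEnd K L V z := hz ▸ toEnd_mul_eq x y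
  have hz' : a * toEnd K L V z = toEnd K L V z * a + toEnd K L V w := hw ▸ toEnd_mul_eq x z
  have hw' : a * toEnd K L V w = toEnd K L V w * a := by
    have := toEnd_mul_eq (K := K) (V := V) x w
    rwa [h0, map_zero, add_zero] at this
  have d0 : d 0 = 1 := by simp [hd]
  have d1 : d 1 = a := by simp [hd]
  have d2 : d 2 = (2⁻¹ : K) • (a * a) := by simp [hd, pow_two]
  clear_value d
  have step (n : ℕ) : d (n + 2) * toEnd K L V y = toEnd K L V y * d (n + 2) +
      toEnd K L V z * d (n + 1) + (2⁻¹ : K) • (toEnd K L V w * d n) := by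
    induction n with
    | zero =>
      simp only [zero_add, d2, d1, d0, mul_one, smul_mul_assoc, mul_smul_comm]
      rw [mul_assoc, hy, mul_add, ← mul_assoc, hy, hz', add_mul, mul_assoc]
      module
    | succ n ih =>
      have h3 : ((n : K) + 3) ≠ 0 := by exact_mod_cast Nat.succ_ne_zero (n + 2)
      have c2 : a * d (n + 2) = ((n : K) + 3) • d (n + 3) := by
        rw [had]; congr 1; push_cast; ring
      have c1 : a * d (n + 1) = ((n : K) + 2) • d (n + 2) := by
        rw [had]; congr 1; push_cast; ring
      have key : ((n : K) + 3) • (d (n + 3) * toEnd K L V y) = ((n : K) + 3) •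
          (toEnd K L V y * d (n + 3) + toEnd K L V z * d (n + 2) +
            (2⁻¹ : K) • (toEnd K L V w * d (n + 1))) := by
        rw [← smul_mul_assoc, ← c2, mul_assoc, ih, mul_add, mul_add, ← mul_assoc, hy, ← mul_assoc,
          hz', mul_smul_comm, ← mul_assoc, hw', add_mul, add_mul, mul_assoc _ a, c2, mul_assoc _ a,
          c1, mul_assoc _ a, had, mul_smul_comm, mul_smul_comm, mul_smul_comm]
        module
      exact smul_right_injective _ h3 key
  have s0 : d 0 * toEnd K L V y = toEnd K L V y * d 0 := by simp [d0]
  have s1 : d 1 * toEnd K L V y = toEnd K L V y * d 1 + toEnd K L V z * d 0 := by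
    rw [d1, d0, hy, mul_one]
  calc expOn K V x * toEnd K L V y
      = ∑ i ∈ Finset.range (N + 2), d i * toEnd K L V y := by rw [e2, Finset.sum_mul]
    _ = toEnd K L V y * ∑ i ∈ Finset.range (N + 2), d i +
        toEnd K L V z * ∑ i ∈ Finset.range (N + 1), d i +
        (2⁻¹ : K) • (toEnd K L V w * ∑ i ∈ Finset.range N, d i) := by
      simp only [Finset.sum_range_succ' _ (N + 1), Finset.sum_range_succ' _ N, Finset.mul_sum,
        Finset.smul_sum, mul_add, step, s0, s1, zero_add, Finset.sum_add_distrib]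
      abel
    _ = _ := by
      rw [← e2, ← e1, ← e0]
      simp only [map_add, map_smul, add_mul, smul_mul_assoc]

end Exponential

/-! ### Two facts about eigenvectors and independent subspaces -/

section LinearAlgebra

variable {K V : Type*} [Field K] [AddCommGroup V] [Module K V]

theorem exists_mem_span_apply_eq {T : End K V} {X : Set V}
    (hX : ∀ x ∈ X, ∃ a : K, a ≠ 0 ∧ T x = a • x) {w : V} (hw : w ∈ Submodule.span K X) :
    ∃ u ∈ Submodule.span K X, T u = w := by
  induction hw using Submodule.span_induction with
  | mem x hx =>
    obtain ⟨a, ha, hax⟩ := hX x hx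
    exact ⟨a⁻¹ • x, Submodule.smul_mem _ _ (Submodule.subset_span hx), by
      rw [map_smul, hax, smul_smul, inv_mul_cancel₀ ha, one_smul]⟩
  | zero => exact ⟨0, zero_mem _, map_zero _⟩
  | add x y _ _ hx hy =>
    obtain ⟨u, hu, rfl⟩ := hx
    obtain ⟨u', hu', rfl⟩ := hy
    exact ⟨u + u', add_mem hu hu', map_add _ _ _⟩
  | smul c x _ hx =>
    obtain ⟨u, hu, rfl⟩ := hx
    exact ⟨c • u, Submodule.smul_mem _ _ hu, map_smul _ _ _⟩

/-- Independent subspaces which contain the members of a spanning family are equal to these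
members. -/
theorem eq_of_le_of_iSupIndep {ι : Type*} {A B : ι → Submodule K V} (hAB : A ≤ B)
    (hB : iSupIndep B) (hA : ⨆ i, A i = ⊤) : A = B := by
  refine funext fun i => le_antisymm (hAB i) fun x hx => ?_
  have h1 : x ∈ A i ⊔ ⨆ j, ⨆ (_ : j ≠ i), A j := by
    have : (⊤ : Submodule K V) ≤ A i ⊔ ⨆ j, ⨆ (_ : j ≠ i), A j := by
      rw [← hA]
      refine iSup_le fun j => ?_
      by_cases hj : j = i
      · subst hj; exact le_sup_left
      · exact le_sup_of_le_right (le_iSup₂_of_le j hj le_rfl)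
    exact this trivial
  obtain ⟨a, ha, c, hc, rfl⟩ := Submodule.mem_sup.mp h1
  have hc' : c ∈ ⨆ j, ⨆ (_ : j ≠ i), B j := (iSup₂_mono fun j _ => hAB j) hc
  have hci : c ∈ B i := by simpa using sub_mem hx (hAB i ha)
  have : c = 0 := Submodule.disjoint_def.mp (hB i) c hci hc'
  simpa [this] using ha

end LinearAlgebra

/-! ### The Weyl element of an `sl₂`-triple and its conjugation action -/

section Sl2

variable {K L : Type*} [Field K] [CharZero K] [LieRing L] [LieAlgebra K L]
  (V : Type*) [AddCommGroup V] [Module K V] [LieRingModule L V] [LieModule K L V]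
  {h e f : L}

variable (K) in
/-- The action of the representative `exp(e) exp(-f) exp(e)` of the nontrivial Weyl group element
of an `sl₂`-triple. -/
def weylOp (e f : L) : End K V := expOn K V e * expOn K V (-f) * expOn K V e

variable {V} [FiniteDimensional K V] (t : IsSl2Triple h e f)
include t

omit [CharZero K] in
theorem lie_e_h : ⁅e, h⁆ = -((2 : K) • e) := by rw [← lie_skew, t.lie_h_e_smul K]

omit [CharZero K] in
theorem lie_f_h : ⁅f, h⁆ = (2 : K) • f := by rw [← lie_skew, t.lie_lie_smul_f K, neg_neg]

omit [CharZero K] in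
theorem lie_f_e : ⁅f, e⁆ = -h := by rw [← lie_skew, t.lie_e_f]

theorem isSl2Triple_neg : IsSl2Triple h (-e) (-f) where
  h_ne_zero := t.h_ne_zero
  lie_e_f := by simpa using t.lie_e_f
  lie_h_e_nsmul := by simp [t.lie_h_e_nsmul]
  lie_h_f_nsmul := by simp [t.lie_h_f_nsmul]

theorem isNilpotent_toEnd_e : IsNilpotent (toEnd K L V e) :=
  isNilpotent_toEnd_of_lie_eq_smul two_ne_zero (t.lie_h_e_smul K)

theorem isNilpotent_toEnd_f : IsNilpotent (toEnd K L V f) :=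
  isNilpotent_toEnd_e t.symm

theorem expOn_e_mul_e :
    expOn K V e * toEnd K L V e = toEnd K L V e * expOn K V e := by
  simpa using expOn_mul_toEnd (isNilpotent_toEnd_e t) (lie_self e) (lie_zero e) (lie_zero e)

theorem expOn_e_mul_h :
    expOn K V e * toEnd K L V h = toEnd K L V (h - (2 : K) • e) * expOn K V e := by
  rw [expOn_mul_toEnd (isNilpotent_toEnd_e t) (lie_e_h (K := K) t) (by simp) (lie_zero e), smul_zero, add_zero, sub_eq_add_neg]

theorem expOn_e_mul_f :
    expOn K V e * toEnd K L V f = toEnd K L V (f + h - e) * expOn K V e := by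
  rw [expOn_mul_toEnd (isNilpotent_toEnd_e t) t.lie_e_f (lie_e_h (K := K) t) (by simp), smul_neg, smul_smul,
    inv_mul_cancel₀ two_ne_zero, one_smul, sub_eq_add_neg]

theorem isSl2Triple_symm_neg : IsSl2Triple (-h) (-f) (-e) := isSl2Triple_neg t.symm

/-- The three exponentials conjugate successively `e ↦ e ↦ e + h - f ↦ -f`. -/
theorem weylOp_mul_e :
    weylOp K V e f * toEnd K L V e = toEnd K L V (-f) * weylOp K V e f := by
  have t' := isSl2Triple_symm_neg t
  have hf := expOn_e_mul_f (K := K) (V := V) t'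
  rw [map_neg _ e, mul_neg, neg_eq_iff_eq_neg] at hf
  rw [weylOp, mul_assoc, expOn_e_mul_e t, ← mul_assoc, mul_assoc (expOn K V e) _ (toEnd K L V e), hf,
    ← neg_mul, ← map_neg, ← mul_assoc]
  have : -(-e + -h - -f) = e + h - f := by abel
  rw [this, map_sub, map_add, mul_sub, mul_add, expOn_e_mul_e t, expOn_e_mul_h t, expOn_e_mul_f t,
    ← add_mul, ← sub_mul, ← map_add, ← map_sub, mul_assoc, mul_assoc, mul_assoc]
  congr 2
  rw [two_smul]; abel

theorem weylOp_mul_h :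
    weylOp K V e f * toEnd K L V h = toEnd K L V (-h) * weylOp K V e f := by
  have t' := isSl2Triple_symm_neg t
  have hh := expOn_e_mul_h (K := K) (V := V) t'
  rw [map_neg _ h, mul_neg, neg_eq_iff_eq_neg] at hh
  have he := expOn_e_mul_f (K := K) (V := V) t'
  rw [map_neg _ e, mul_neg, neg_eq_iff_eq_neg] at he
  rw [weylOp, mul_assoc, expOn_e_mul_h t, map_sub, sub_mul, map_smul, mul_sub, ← mul_assoc,
    mul_assoc (expOn K V e) _ (toEnd K L V h), hh, smul_mul_assoc, mul_smul_comm, ← mul_assoc _ _ (expOn K V e),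
    mul_assoc (expOn K V e) _ (toEnd K L V e), he,
    ← neg_mul, ← map_neg, ← neg_mul, ← map_neg, ← mul_assoc, ← mul_assoc, mul_assoc,
    mul_assoc (expOn K V e * _), ← smul_mul_assoc, ← sub_mul, ← mul_smul_comm, ← map_smul,
    ← mul_sub, ← map_sub]
  have : -(-h - (2 : K) • -f) - (2 : K) • -(-e + -h - -f) =
      (2 : K) • (-e) - h := by module
  rw [this, map_sub, map_smul, map_neg, mul_sub, smul_neg, mul_neg, mul_smul_comm,
    expOn_e_mul_e t, expOn_e_mul_h t, ← smul_mul_assoc, ← neg_mul, ← sub_mul, ← map_smul,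
    ← map_neg, ← map_sub, mul_assoc, mul_assoc]
  congr 2
  module

theorem weylOp_mul_weylOp_neg : weylOp K V e f * weylOp K V (-e) (-f) = 1 := by
  have h1 := expOn_mul_expOn_neg (isNilpotent_toEnd_e (K := K) (V := V) t)
  have h2 := expOn_neg_mul_expOn (isNilpotent_toEnd_f (K := K) (V := V) t)
  simp only [weylOp, neg_neg, mul_assoc]
  rw [← mul_assoc (expOn K V e) (expOn K V (-e)), h1, one_mul, ← mul_assoc (expOn K V (-f)), h2,
    one_mul, h1]

theorem weylOp_neg_mul_weylOp : weylOp K V (-e) (-f) * weylOp K V e f = 1 := by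
  simpa using weylOp_mul_weylOp_neg (K := K) (V := V) (isSl2Triple_neg t)

/-- Write `W` for the left side. As `W` conjugates `e` to `-f`, it conjugates `exp e` to `exp (-f)`;
hence `W = W exp(e) exp(-e) = exp(-f) W exp(-e) = exp(-f) exp(e) exp(-f)`. This symmetry carries
statements on highest vectors over to lowest vectors. -/
theorem weylOp_eq_weylOp_neg_symm : weylOp K V e f = weylOp K V (-f) (-e) := by
  obtain ⟨N, hN⟩ := isNilpotent_toEnd_e (K := K) (V := V) t
  obtain ⟨M, hM⟩ := isNilpotent_toEnd_e (K := K) (V := V) (isSl2Triple_symm_neg t)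
  have hN' : toEnd K L V e ^ (N + M) = 0 := by rw [pow_add, hN, zero_mul]
  have hM' : toEnd K L V (-f) ^ (N + M) = 0 := by rw [pow_add, hM, mul_zero]
  have hpow (i : ℕ) : weylOp K V e f * toEnd K L V e ^ i =
      toEnd K L V (-f) ^ i * weylOp K V e f := by
    induction i with
    | zero => simp
    | succ i ih => rw [pow_succ, ← mul_assoc, ih, mul_assoc, weylOp_mul_e t, ← mul_assoc, ← pow_succ]
  have key : weylOp K V e f * expOn K V e = expOn K V (-f) * weylOp K V e f := by
    rw [expOn_eq_sum hN', expOn_eq_sum hM', Finset.mul_sum, Finset.sum_mul]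
    exact Finset.sum_congr rfl fun i _ => by rw [mul_smul_comm, smul_mul_assoc, hpow]
  have h1 := expOn_mul_expOn_neg (isNilpotent_toEnd_e (K := K) (V := V) t)
  calc weylOp K V e f = weylOp K V e f * expOn K V e * expOn K V (-e) := by
        rw [mul_assoc, h1, mul_one]
    _ = _ := by
      rw [key, weylOp, weylOp, mul_assoc, mul_assoc, h1, mul_one, neg_neg, mul_assoc]

theorem weylOp_mul_f :
    weylOp K V e f * toEnd K L V f = toEnd K L V (-e) * weylOp K V e f := by
  have := weylOp_mul_e (K := K) (V := V) (isSl2Triple_symm_neg t)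
  rw [← weylOp_eq_weylOp_neg_symm t, neg_neg, map_neg, mul_neg, neg_eq_iff_eq_neg] at this
  rw [this, map_neg, neg_mul]

end Sl2

/-! ### Finite-dimensional `sl₂`-modules are spanned by strings -/

section Sl2Strings

variable {K L : Type*} [Field K] [CharZero K] [LieRing L] [LieAlgebra K L]
  {V : Type*} [AddCommGroup V] [Module K V] [LieRingModule L V] [LieModule K L V]
  {h e f : L}

omit [CharZero K] in
theorem lie_h_pow_f (t : IsSl2Triple h e f) {v : V} {μ : K} (hv : ⁅h, v⁆ = μ • v) (n : ℕ) :
    ⁅h, (toEnd K L V f ^ n) v⁆ = (μ - 2 * n) • (toEnd K L V f ^ n) v := by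
  have := t.symm.lie_h_pow_toEnd_e (R := K) (m := v) (μ := -μ) (by rw [neg_lie, hv, neg_smul]) n
  rw [neg_lie, neg_eq_iff_eq_neg, ← neg_smul] at this
  rw [this]; congr 1; ring

omit [CharZero K] in
theorem lie_e_pow_succ_f (t : IsSl2Triple h e f) {v : V} {μ : K} (hv : ⁅h, v⁆ = μ • v)
    (he : ⁅e, v⁆ = 0) (n : ℕ) :
    ⁅e, (toEnd K L V f ^ (n + 1)) v⁆ = ((n + 1) * (μ - n)) • (toEnd K L V f ^ n) v := by
  by_cases h0 : v = 0
  · simp [h0]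
  · exact (IsSl2Triple.HasPrimitiveVectorWith.lie_e_pow_succ_toEnd_f
      (t := t) ⟨h0, hv, he⟩ n)

theorem pow_f_eq_zero [FiniteDimensional K V] (t : IsSl2Triple h e f) {v : V} {m : ℕ}
    (hv : ⁅h, v⁆ = (m : K) • v) (he : ⁅e, v⁆ = 0) {n : ℕ} (hn : m < n) :
    (toEnd K L V f ^ n) v = 0 := by
  by_cases h0 : v = 0
  · simp [h0]
  · have := IsSl2Triple.HasPrimitiveVectorWith.pow_toEnd_f_eq_zero_of_eq_nat (R := K)
      (t := t) (m := v) (μ := (m : K)) ⟨h0, hv, he⟩ rfl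
    obtain ⟨k, rfl⟩ := Nat.exists_eq_add_of_le' hn
    rw [pow_add, Module.End.mul_apply, this, map_zero]

omit [CharZero K] in
theorem lie_e_pow_succ_f_of_lie_f_lie_e (t : IsSl2Triple h e f) {u : V} (hu : ⁅f, ⁅e, u⁆⁆ = 0) (n : ℕ) :
    ⁅e, (toEnd K L V f ^ (n + 1)) u⁆ =
      (n + 1 : K) • (toEnd K L V f ^ n) (⁅h, u⁆ - (n : K) • u) := by
  induction n with
  | zero => simp [leibniz_lie e, t.lie_e_f, hu]
  | succ n ih =>
    have hc (k : ℕ) (w : V) : ⁅h, (toEnd K L V f ^ k) w⁆ =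
        (toEnd K L V f ^ k) ⁅h, w⁆ - (2 * k : K) • (toEnd K L V f ^ k) w := by
      induction k with
      | zero => simp
      | succ k ihk =>
        rw [pow_succ', Module.End.mul_apply, toEnd_apply_apply, leibniz_lie h, t.lie_lie_smul_f K, ihk,
          lie_sub, neg_lie, lie_smul, smul_lie, Module.End.mul_apply, toEnd_apply_apply]
        push_cast
        module
    rw [pow_succ' _ (n + 1), Module.End.mul_apply, toEnd_apply_apply, leibniz_lie e, t.lie_e_f, ih, hc,
      lie_smul, ← toEnd_apply_apply K L V f, ← Module.End.mul_apply, ← pow_succ']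
    simp only [map_sub, map_smul]
    push_cast
    module

/-- When `f e u = 0`, the commutation formula gives `e^n f^n u = n! ∏_{j<n} (h - j) u`, and the left
side vanishes for `n = N`. The induction passes from `u` to `(h - n) u`, which satisfies the same
hypothesis. -/
theorem aeval_prod_of_lie_f_lie_e (t : IsSl2Triple h e f) {u : V} (hu : ⁅f, ⁅e, u⁆⁆ = 0) {N : ℕ}
    (hN : toEnd K L V f ^ N = 0) :
    Polynomial.aeval (toEnd K L V h)
      (∏ j ∈ Finset.range N, (Polynomial.X - Polynomial.C (j : K))) u = 0 := by
  have key (n : ℕ) : ∀ u : V, ⁅f, ⁅e, u⁆⁆ = 0 →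
      (toEnd K L V e ^ n) ((toEnd K L V f ^ n) u) = (n.factorial : K) •
        Polynomial.aeval (toEnd K L V h)
          (∏ j ∈ Finset.range n, (Polynomial.X - Polynomial.C (j : K))) u := by
    induction n with
    | zero => intro u _; simp
    | succ n ih =>
      intro u hu
      have hu' : ⁅f, ⁅e, ⁅h, u⁆ - (n : K) • u⁆⁆ = 0 := by
        have h1 : ⁅f, ⁅e, ⁅h, u⁆⁆⁆ = ⁅h, ⁅f, ⁅e, u⁆⁆⁆ := by
          simp only [leibniz_lie e h, leibniz_lie f, lie_e_h (K := K) t, lie_f_h (K := K) t, lie_add, neg_lie, smul_lie, lie_neg, lie_smul, lie_f_e t]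
          simp
          abel
        simp [h1, hu]
      rw [pow_succ, Module.End.mul_apply, toEnd_apply_apply, lie_e_pow_succ_f_of_lie_f_lie_e t hu, map_smul,
        ih _ hu', smul_smul, Finset.prod_range_succ, map_mul, Module.End.mul_apply, Nat.factorial_succ]
      simp only [map_sub, map_smul, Polynomial.aeval_X, Polynomial.aeval_C, LinearMap.sub_apply,
        toEnd_apply_apply, Module.algebraMap_end_apply]
      push_cast
      module
  have := key N u hu
  rw [hN, LinearMap.zero_apply, map_zero] at this
  exact (smul_eq_zero.mp this.symm).resolve_left (by exact_mod_cast N.factorial_ne_zero)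

variable [FiniteDimensional K V]

include K in
-- The vector `e u` is killed by a product of factors `h - (j + 2)`, because `u` is killed by one of
-- factors `h - j`. Being killed by `f`, it is also killed by a product of factors `h + j`. The
-- eigenvalues allowed are at least 2 and at most 0, so the two polynomials are coprime.
theorem lie_e_eq_zero_of_lie_f_lie_e (t : IsSl2Triple h e f) {u : V} (hu : ⁅f, ⁅e, u⁆⁆ = 0) :
    ⁅e, u⁆ = 0 := by
  obtain ⟨N, hN⟩ := isNilpotent_toEnd_f (K := K) (V := V) t
  obtain ⟨M, hM⟩ := isNilpotent_toEnd_e (K := K) (V := V) t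
  have h1 := aeval_prod_of_lie_f_lie_e t hu hN
  have h2 := aeval_prod_of_lie_f_lie_e (u := ⁅e, u⁆) t.symm (by rw [hu, lie_zero]) hM
  have h1' : Polynomial.aeval (toEnd K L V h)
      (∏ j ∈ Finset.range N, (Polynomial.X - Polynomial.C (j + 2 : K))) ⁅e, u⁆ = 0 := by
    have comm : ∀ n (u : V), Polynomial.aeval (toEnd K L V h)
        (∏ j ∈ Finset.range n, (Polynomial.X - Polynomial.C (j + 2 : K))) ⁅e, u⁆ =
        ⁅e, Polynomial.aeval (toEnd K L V h)
          (∏ j ∈ Finset.range n, (Polynomial.X - Polynomial.C (j : K))) u⁆ := by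
      intro n
      induction n with
      | zero => simp
      | succ n ih =>
        intro u
        rw [Finset.prod_range_succ, Finset.prod_range_succ, map_mul, map_mul, Module.End.mul_apply,
          Module.End.mul_apply, ← ih]
        congr 1
        simp only [map_sub, Polynomial.aeval_X, Polynomial.aeval_C, LinearMap.sub_apply,
          toEnd_apply_apply, Module.algebraMap_end_apply, lie_sub, lie_smul, leibniz_lie h,
          t.lie_h_e_smul K, smul_lie]
        module
    rw [comm, h1, lie_zero]
  have h2' : Polynomial.aeval (toEnd K L V h)
      (∏ j ∈ Finset.range M, (Polynomial.X - Polynomial.C (-j : K))) ⁅e, u⁆ = 0 := by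
    have conv : ∀ n (u : V), Polynomial.aeval (toEnd K L V (-h))
        (∏ j ∈ Finset.range n, (Polynomial.X - Polynomial.C (j : K))) u = ((-1) ^ n : K) •
        Polynomial.aeval (toEnd K L V h)
          (∏ j ∈ Finset.range n, (Polynomial.X - Polynomial.C (-j : K))) u := by
      intro n
      induction n with
      | zero => simp
      | succ n ih =>
        intro u
        rw [Finset.prod_range_succ, Finset.prod_range_succ, map_mul, map_mul, Module.End.mul_apply,
          Module.End.mul_apply, ih, pow_succ, mul_smul, ← map_smul _ (-1 : K)]
        congr 2
        simp
        abel
    rw [conv] at h2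
    exact (smul_eq_zero.mp h2).resolve_left (by simp)
  have hcop : IsCoprime (∏ j ∈ Finset.range N, (Polynomial.X - Polynomial.C (j + 2 : K)))
      (∏ j ∈ Finset.range M, (Polynomial.X - Polynomial.C (-j : K))) := by
    refine IsCoprime.prod_left fun i _ => IsCoprime.prod_right fun j _ => ?_
    refine Polynomial.isCoprime_X_sub_C_of_isUnit_sub (IsUnit.mk0 _ ?_)
    have : ((i + 2 + j : ℕ) : K) ≠ 0 := Nat.cast_ne_zero.mpr (by omega)
    intro h0
    apply this
    push_cast
    linear_combination h0
  exact Submodule.disjoint_def.mp (Polynomial.disjoint_ker_aeval_of_isCoprime _ hcop) _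
    (LinearMap.mem_ker.mpr h1') (LinearMap.mem_ker.mpr h2')

/-- Vectors killed by `e` are sums of eigenvectors of `h` with natural eigenvalues. -/
theorem mem_span_of_lie_e_eq_zero (t : IsSl2Triple h e f) {v : V} (hv : ⁅e, v⁆ = 0) :
    v ∈ Submodule.span K {v : V | ⁅e, v⁆ = 0 ∧ ∃ m : ℕ, ⁅h, v⁆ = (m : K) • v} := by
  obtain ⟨N, hN⟩ := isNilpotent_toEnd_f (K := K) (V := V) t
  have h1 := aeval_prod_of_lie_f_lie_e (u := v) t (by rw [hv, lie_zero]) hN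
  have key (n : ℕ) : ∀ v : V, ⁅e, v⁆ = 0 → Polynomial.aeval (toEnd K L V h)
      (∏ j ∈ Finset.range n, (Polynomial.X - Polynomial.C (j : K))) v = 0 →
      v ∈ Submodule.span K {v : V | ⁅e, v⁆ = 0 ∧ ∃ m < n, ⁅h, v⁆ = (m : K) • v} := by
    induction n with
    | zero => intro v _ hv; simp_all
    | succ n ih =>
      intro v hv hp
      rw [Finset.prod_range_succ, map_mul, Module.End.mul_apply] at hp
      have he : ⁅e, Polynomial.aeval (toEnd K L V h) (Polynomial.X - Polynomial.C (n : K)) v⁆ = 0 := by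
        simp [leibniz_lie e, hv, lie_e_h (K := K) t]
      have hw := ih _ he hp
      obtain ⟨u, hu, huw⟩ := exists_mem_span_apply_eq
        -- On eigenvectors of eigenvalue `m < n` the operator `h - n` is invertible, so `(h - n) v`
        -- has a preimage `u` in their span. The difference `v - u` is then an eigenvector of
        -- eigenvalue `n`.
        (T := Polynomial.aeval (toEnd K L V h) (Polynomial.X - Polynomial.C (n : K))) (by
          rintro x ⟨-, m, hm, hx⟩
          refine ⟨(m : K) - n, ?_, ?_⟩
          · rw [sub_ne_zero]; exact_mod_cast hm.ne
          · simp only [map_sub, Polynomial.aeval_X, Polynomial.aeval_C, LinearMap.sub_apply,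
              toEnd_apply_apply, Module.algebraMap_end_apply, hx, sub_smul]) hw
      have hsub : v - u ∈ {v : V | ⁅e, v⁆ = 0 ∧ ∃ m < n + 1, ⁅h, v⁆ = (m : K) • v} := by
        refine ⟨?_, n, n.lt_succ_self, ?_⟩
        · have : u ∈ LinearMap.ker (toEnd K L V e) :=
            Submodule.span_le.mpr (fun x hx => hx.1) hu
          rw [lie_sub, hv, ← toEnd_apply_apply K L V e u, LinearMap.mem_ker.mp this, sub_zero]
        · rw [← sub_eq_zero]
          simp only [map_sub, Polynomial.aeval_X, Polynomial.aeval_C, LinearMap.sub_apply,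
            toEnd_apply_apply, Module.algebraMap_end_apply] at huw
          rw [lie_sub, smul_sub, sub_sub_sub_comm, huw, sub_self]
      rw [← sub_add_cancel v u]
      refine add_mem (Submodule.subset_span hsub) (Submodule.span_mono ?_ hu)
      rintro x ⟨hx, m, hm, hxm⟩
      exact ⟨hx, m, hm.trans n.lt_succ_self, hxm⟩
  refine Submodule.span_mono ?_ (key N v hv h1)
  rintro x ⟨hx, m, -, hxm⟩
  exact ⟨hx, m, hxm⟩

/-- A finite-dimensional representation of `sl₂` is spanned by the strings through the primitive
vectors. -/
theorem span_strings_eq_top (t : IsSl2Triple h e f) :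
    Submodule.span K {x : V | ∃ (m i : ℕ) (v : V), ⁅e, v⁆ = 0 ∧ ⁅h, v⁆ = (m : K) • v ∧
      x = (toEnd K L V f ^ i) v} = ⊤ := by
  set S := Submodule.span K {x : V | ∃ (m i : ℕ) (v : V), ⁅e, v⁆ = 0 ∧ ⁅h, v⁆ = (m : K) • v ∧
      x = (toEnd K L V f ^ i) v} with hS
  have hker {v : V} (hv : ⁅e, v⁆ = 0) : v ∈ S :=
    Submodule.span_mono (by rintro x ⟨hx, m, hm⟩; exact ⟨m, 0, x, hx, hm, rfl⟩)
      (mem_span_of_lie_e_eq_zero t hv)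
  -- Within a string, `f^i v` is a nonzero multiple of `e f^(i+1) v` for `i < m`, and is killed by
  -- `f` otherwise. So modulo `e S` every element of `S` is killed by `f`.
  have hdec : ∀ x ∈ S, ∃ s ∈ S, ⁅f, x - ⁅e, s⁆⁆ = 0 := by
    intro x hx
    induction hx using Submodule.span_induction with
    | mem x hx =>
      obtain ⟨m, i, v, he, hh, rfl⟩ := hx
      by_cases hi : i < m
      · refine ⟨((i + 1) * ((m : K) - i))⁻¹ • (toEnd K L V f ^ (i + 1)) v,
          Submodule.smul_mem _ _ (Submodule.subset_span ⟨m, i + 1, v, he, hh, rfl⟩), ?_⟩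
        have h1 : (i + 1) * ((m : K) - i) ≠ 0 := by
          refine mul_ne_zero (Nat.cast_add_one_ne_zero i) (sub_ne_zero.mpr ?_)
          exact_mod_cast hi.ne'
        rw [lie_smul, lie_e_pow_succ_f t hh he, smul_smul, inv_mul_cancel₀ h1, one_smul, sub_self,
          lie_zero]
      · refine ⟨0, zero_mem _, ?_⟩
        rw [lie_zero, sub_zero, ← toEnd_apply_apply K L V f, ← Module.End.mul_apply, ← pow_succ']
        exact pow_f_eq_zero t hh he (by omega)
    | zero => exact ⟨0, zero_mem _, by simp⟩
    | add x y _ _ hx hy =>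
      obtain ⟨s, hs, hs'⟩ := hx
      obtain ⟨s', hs1, hs1'⟩ := hy
      exact ⟨s + s', add_mem hs hs1, by rw [lie_add, add_sub_add_comm, lie_add, hs', hs1', add_zero]⟩
    | smul c x _ hx =>
      obtain ⟨s, hs, hs'⟩ := hx
      exact ⟨c • s, Submodule.smul_mem _ _ hs, by rw [lie_smul, ← smul_sub, lie_smul, hs', smul_zero]⟩
  obtain ⟨N, hN⟩ := isNilpotent_toEnd_e (K := K) (V := V) t
  -- If `e v ∈ S`, choose `s ∈ S` with `f e (v - s) = 0`. Then `e (v - s) = 0`, and vectors killed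
  -- by `e` lie in `S`.
  have hall (k : ℕ) : ∀ v : V, (toEnd K L V e ^ k) v = 0 → v ∈ S := by
    induction k with
    | zero => intro v hv; have : v = 0 := hv; rw [this]; exact zero_mem _
    | succ k ih =>
      intro v hv
      obtain ⟨s, hs, hs'⟩ := hdec ⁅e, v⁆ (ih _ (by rwa [pow_succ] at hv))
      rw [← lie_sub] at hs'
      have := hker (lie_e_eq_zero_of_lie_f_lie_e (K := K) t hs')
      simpa using add_mem this hs
  exact Submodule.eq_top_iff'.mpr fun v => hall N v (by rw [hN, LinearMap.zero_apply])

end Sl2Strings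

/-! ### The action of the Weyl element on strings -/

section WeylOperator

variable {K L : Type*} [Field K] [CharZero K] [LieRing L] [LieAlgebra K L]
  {V : Type*} [AddCommGroup V] [Module K V] [LieRingModule L V] [LieModule K L V]
  [FiniteDimensional K V] {h e f : L}

theorem lie_h_weylOp (t : IsSl2Triple h e f) {v : V} {μ : K} (hv : ⁅h, v⁆ = μ • v) :
    ⁅h, weylOp K V e f v⁆ = -μ • weylOp K V e f v := by
  have := LinearMap.congr_fun (weylOp_mul_h (K := K) (V := V) t) v
  simp only [Module.End.mul_apply, toEnd_apply_apply, hv, neg_lie, map_smul] at this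
  rw [neg_smul, this, neg_neg]

theorem weylOp_apply_lie_e (t : IsSl2Triple h e f) (v : V) :
    weylOp K V e f ⁅e, v⁆ = -⁅f, weylOp K V e f v⁆ := by
  simpa using LinearMap.congr_fun (weylOp_mul_e (K := K) (V := V) t) v

theorem weylOp_apply_lie_f (t : IsSl2Triple h e f) (v : V) :
    weylOp K V e f ⁅f, v⁆ = -⁅e, weylOp K V e f v⁆ := by
  simpa using LinearMap.congr_fun (weylOp_mul_f (K := K) (V := V) t) v

/-- Since `exp(e) v = v`, the vector `y = W v` satisfies `exp(-e) y = exp(-f) v`. Here `y` has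
`h`-eigenvalue `-m`, and all further terms on the left have larger eigenvalues. Comparing the
components of eigenvalue `-m` leaves only the last term `(-f)^m v / m!` on the right. -/
theorem weylOp_apply_highest (t : IsSl2Triple h e f) {v : V} {m : ℕ} (he : ⁅e, v⁆ = 0)
    (hv : ⁅h, v⁆ = (m : K) • v) :
    weylOp K V e f v = (m.factorial : K)⁻¹ • (toEnd K L V (-f) ^ m) v := by
  have hne := isNilpotent_toEnd_e (K := K) (V := V) t
  have hnf := isNilpotent_toEnd_f (K := K) (V := V) (isSl2Triple_neg t)
  obtain ⟨N, hN⟩ := isNilpotent_toEnd_e (K := K) (V := V) (isSl2Triple_neg t)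
  set y := weylOp K V e f v with hy
  have hev : expOn K V e v = v := by
    rw [expOn_apply_eq_sum (k := 1) hne (by simpa using he)]; simp
  have h1 : expOn K V (-e) y = expOn K V (-f) v := by
    rw [hy, weylOp, Module.End.mul_apply, hev, Module.End.mul_apply, ← Module.End.mul_apply,
      expOn_neg_mul_expOn hne, Module.End.one_apply]
  rw [expOn_eq_sum (k := N + 1) (by rw [pow_succ, hN, zero_mul]), LinearMap.sum_apply,
    Finset.sum_range_succ', expOn_apply_eq_sum (k := m + 1) hnf
      (pow_f_eq_zero (isSl2Triple_neg t) hv (by simpa using he) m.lt_succ_self),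
    Finset.sum_range_succ] at h1
  simp only [Nat.factorial_zero, Nat.cast_one, inv_one, pow_zero, one_smul, Module.End.one_apply]
    at h1
  have hyw : ⁅h, y⁆ = (-(m : K)) • y := lie_h_weylOp t hv
  set E := (toEnd K L V h).eigenspace
  have hindep := (toEnd K L V h).eigenspaces_iSupIndep
  have hf (i : ℕ) : (toEnd K L V (-f) ^ i) v ∈ E (m - 2 * i) := by
    rw [Module.End.mem_eigenspace_iff]
    exact lie_h_pow_f (isSl2Triple_neg t) hv i
  have hme (i : ℕ) : (toEnd K L V (-e) ^ i) y ∈ E (-(m : K) + 2 * i) := by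
    rw [Module.End.mem_eigenspace_iff]
    exact (isSl2Triple_neg t).lie_h_pow_toEnd_e hyw i
  have hmem1 : y - (m.factorial : K)⁻¹ • (toEnd K L V (-f) ^ m) v ∈ E (-(m : K)) := by
    refine sub_mem ?_ (Submodule.smul_mem _ _ ?_)
    · simpa using hme 0
    · convert hf m using 2; ring
  have hmem2 : y - (m.factorial : K)⁻¹ • (toEnd K L V (-f) ^ m) v ∈
      ⨆ μ, ⨆ (_ : μ ≠ -(m : K)), E μ := by
    have : y - (m.factorial : K)⁻¹ • (toEnd K L V (-f) ^ m) v =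
        ∑ i ∈ Finset.range m, (i.factorial : K)⁻¹ • (toEnd K L V (-f) ^ i) v -
        ∑ i ∈ Finset.range N, ((i + 1).factorial : K)⁻¹ • (toEnd K L V (-e) ^ (i + 1)) y := by
      rw [sub_eq_sub_iff_add_eq_add, add_comm y]
      exact h1
    rw [this]
    refine sub_mem (Submodule.sum_mem _ fun i hi => Submodule.smul_mem _ _ ?_)
      (Submodule.sum_mem _ fun i _ => Submodule.smul_mem _ _ ?_)
    · refine Submodule.mem_iSup_of_mem _ (Submodule.mem_iSup_of_mem ?_ (hf i))
      intro h0
      have : ((m + m : ℕ) : K) = (2 * i : ℕ) := by push_cast; linear_combination h0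
      rw [Finset.mem_range] at hi
      have := Nat.cast_injective this
      omega
    · refine Submodule.mem_iSup_of_mem _ (Submodule.mem_iSup_of_mem ?_ (hme (i + 1)))
      rw [Ne, add_eq_left]
      exact mul_ne_zero two_ne_zero (Nat.cast_ne_zero.mpr i.succ_ne_zero)
  exact sub_eq_zero.mp (Submodule.disjoint_def.mp (hindep _) _ hmem1 hmem2)

theorem weylOp_apply_lowest (t : IsSl2Triple h e f) {v : V} {m : ℕ} (hf : ⁅f, v⁆ = 0)
    (hv : ⁅h, v⁆ = -(m : K) • v) :
    weylOp K V e f v = (m.factorial : K)⁻¹ • (toEnd K L V e ^ m) v := by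
  have := weylOp_apply_highest (K := K) (V := V) (m := m) (v := v) (isSl2Triple_symm_neg t)
    (by simpa using hf) (by rw [neg_lie, hv, neg_smul, neg_neg])
  rwa [neg_neg, ← weylOp_eq_weylOp_neg_symm t] at this

theorem weylOp_weylOp_highest (t : IsSl2Triple h e f) {v : V} {m : ℕ} (he : ⁅e, v⁆ = 0)
    (hv : ⁅h, v⁆ = (m : K) • v) :
    weylOp K V e f (weylOp K V e f v) = (-1 : K) ^ m • v := by
  have h1 := weylOp_apply_highest t he hv
  have h2 := weylOp_apply_highest (isSl2Triple_neg t) (v := v) (m := m) (by simpa using he) hv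
  have h3 : weylOp K V e f v = (-1 : K) ^ m • weylOp K V (-e) (-f) v := by
    rw [h1, h2, neg_neg, map_neg, ← neg_one_smul K (toEnd K L V f), smul_pow, LinearMap.smul_apply,
      smul_comm]
  rw [h3, map_smul, ← Module.End.mul_apply, weylOp_mul_weylOp_neg t, Module.End.one_apply]

theorem weylOp_weylOp_apply_lie_f (t : IsSl2Triple h e f) (v : V) :
    weylOp K V e f (weylOp K V e f ⁅f, v⁆) = ⁅f, weylOp K V e f (weylOp K V e f v)⁆ := by
  rw [weylOp_apply_lie_f t, map_neg, weylOp_apply_lie_e t, neg_neg]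

/-- The square of the Weyl element commutes with `f`, so on the string through a highest vector of
weight `m` it is the constant `(-1)^m`, which equals `(-1)^(m - 2i)`. Intersecting with the kernel
lets `eq_of_le_of_iSupIndep` transfer the sign from strings to arbitrary eigenvectors. -/
theorem iSup_eigenspace_inf_ker_eq_top (t : IsSl2Triple h e f) :
    ⨆ n : ℤ, ((toEnd K L V h).eigenspace (n : K) ⊓ LinearMap.ker
      (weylOp K V e f * weylOp K V e f - (((-1 : Kˣ) ^ n : Kˣ) : K) • (1 : End K V))) = ⊤ := by
  rw [eq_top_iff, ← span_strings_eq_top (K := K) (V := V) t, Submodule.span_le]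
  rintro x ⟨m, i, v, he, hv, rfl⟩
  refine Submodule.mem_iSup_of_mem ((m : ℤ) - 2 * i) ⟨?_, ?_⟩
  · rw [SetLike.mem_coe, Module.End.mem_eigenspace_iff]
    have hcast : (((m : ℤ) - 2 * i : ℤ) : K) = m - 2 * i := by push_cast; rfl
    rw [hcast]
    exact lie_h_pow_f t hv i
  · have hsign : (((-1 : Kˣ) ^ ((m : ℤ) - 2 * i) : Kˣ) : K) = (-1) ^ m := by
      rw [zpow_sub, zpow_mul]; simp
    have : weylOp K V e f (weylOp K V e f ((toEnd K L V f ^ i) v)) =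
        (-1 : K) ^ m • (toEnd K L V f ^ i) v := by
      induction i with
      | zero => exact weylOp_weylOp_highest t he hv
      | succ i ih =>
        rw [pow_succ', Module.End.mul_apply, toEnd_apply_apply, weylOp_weylOp_apply_lie_f t,
          ih (by rw [zpow_sub, zpow_mul]; simp), lie_smul]
    rw [SetLike.mem_coe, LinearMap.mem_ker, hsign, LinearMap.sub_apply, Module.End.mul_apply, this]
    simp

theorem iSup_eigenspace_eq_top (t : IsSl2Triple h e f) :
    ⨆ n : ℤ, (toEnd K L V h).eigenspace (n : K) = ⊤ :=
  top_unique ((iSup_eigenspace_inf_ker_eq_top t).ge.trans (iSup_mono fun _ => inf_le_left))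

theorem weylOp_weylOp_apply (t : IsSl2Triple h e f) {v : V} {n : ℤ} (hv : ⁅h, v⁆ = (n : K) • v) :
    weylOp K V e f (weylOp K V e f v) = (((-1 : Kˣ) ^ n : Kˣ) : K) • v := by
  have hindep := ((toEnd K L V h).eigenspaces_iSupIndep).comp (Int.cast_injective (α := K))
  have := congrFun (eq_of_le_of_iSupIndep (fun _ => inf_le_left) hindep
    (iSup_eigenspace_inf_ker_eq_top (K := K) (V := V) t)) n
  have hv' : v ∈ (toEnd K L V h).eigenspace (n : K) := Module.End.mem_eigenspace_iff.mpr hv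
  have hv'' := (this.ge hv').2
  rw [SetLike.mem_coe, LinearMap.mem_ker, LinearMap.sub_apply, sub_eq_zero] at hv''
  simpa using hv''

theorem weylOp_apply_of_lie_eq_zero (t : IsSl2Triple h e f) {v : V} (he : ⁅e, v⁆ = 0)
    (hf : ⁅f, v⁆ = 0) : weylOp K V e f v = v := by
  have hh : ⁅h, v⁆ = 0 := by rw [← t.lie_e_f, lie_lie, he, hf]; simp
  simpa using weylOp_apply_lowest (K := K) (m := 0) t hf (by simpa using hh)

/-- The middle vector of a three-dimensional string changes its sign. -/
theorem weylOp_apply_lie_e_of_lowest_two (t : IsSl2Triple h e f) {v : V} (hf : ⁅f, v⁆ = 0)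
    (hv : ⁅h, v⁆ = -(2 : K) • v) : weylOp K V e f ⁅e, v⁆ = -⁅e, v⁆ := by
  have h1 := weylOp_apply_lowest (K := K) (m := 2) t hf (by simpa using hv)
  have h2 : ⁅f, ⁅e, v⁆⁆ = (2 : K) • v := by
    rw [leibniz_lie f, hf, lie_f_e t, neg_lie, hv]; simp
  have h3 : ⁅f, ⁅e, ⁅e, v⁆⁆⁆ = (2 : K) • ⁅e, v⁆ := by
    rw [leibniz_lie f, h2, lie_f_e t, neg_lie, leibniz_lie h, hv, t.lie_h_e_smul K]
    simp
  rw [weylOp_apply_lie_e t, h1, pow_two, Module.End.mul_apply, toEnd_apply_apply,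
    toEnd_apply_apply, lie_smul, h3, smul_smul]
  simp

theorem weylOp_apply_lie_e_of_lowest_one (t : IsSl2Triple h e f) {v : V} (hf : ⁅f, v⁆ = 0)
    (hv : ⁅h, v⁆ = -v) : weylOp K V e f ⁅e, v⁆ = -v := by
  have h1 := weylOp_apply_lowest (K := K) (m := 1) t hf (by simpa using hv)
  rw [weylOp_apply_lie_e t, h1]
  simp [leibniz_lie f, hf, lie_f_e t, hv]

theorem commute_weylOp (t : IsSl2Triple h e f) {x : L} (he : ⁅e, x⁆ = 0) (hf : ⁅f, x⁆ = 0) :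
    Commute (weylOp K V e f) (toEnd K L V x) := by
  have h1 : Commute (expOn K V e) (toEnd K L V x) := by
    have := expOn_mul_toEnd (isNilpotent_toEnd_e (K := K) (V := V) t) he (lie_zero e) (lie_zero e)
    simpa [commute_iff_eq] using this
  have h2 : Commute (expOn K V (-f)) (toEnd K L V x) := by
    have := expOn_mul_toEnd (isNilpotent_toEnd_e (K := K) (V := V) (isSl2Triple_symm_neg t))
      (y := x) (by rw [neg_lie, hf, neg_zero]) (lie_zero _) (lie_zero _)
    simpa [commute_iff_eq] using this
  exact (h1.mul_left h2).mul_left h1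

omit [FiniteDimensional K V] in
theorem commute_expOn {x : L} {T : End K V} (hx : IsNilpotent (toEnd K L V x))
    (hT : Commute T (toEnd K L V x)) : Commute T (expOn K V x) := by
  obtain ⟨N, hN⟩ := hx
  rw [expOn_eq_sum hN]
  exact Commute.sum_right _ _ _ fun i _ => (hT.pow_right i).smul_right _

theorem commute_weylOp_weylOp (t : IsSl2Triple h e f) {h' e' f' : L} (t' : IsSl2Triple h' e' f')
    (h1 : ⁅e, e'⁆ = 0) (h2 : ⁅f, e'⁆ = 0) (h3 : ⁅e, f'⁆ = 0) (h4 : ⁅f, f'⁆ = 0) :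
    Commute (weylOp K V e f) (weylOp K V e' f') := by
  have c1 := commute_expOn (isNilpotent_toEnd_e t') (commute_weylOp (K := K) (V := V) t h1 h2)
  have c2 := commute_expOn (isNilpotent_toEnd_e (isSl2Triple_symm_neg t'))
    (commute_weylOp (K := K) (V := V) t (x := -f') (by rw [lie_neg, h3, neg_zero])
      (by rw [lie_neg, h4, neg_zero]))
  exact (c1.mul_right c2).mul_right c1

end WeylOperator

/-! ### Reduced words, inversions and the additivity of `F` -/

section Words

variable {ι R M N : Type*} [Fintype ι] [Field R] [CharZero R]
  [AddCommGroup M] [Module R M] [AddCommGroup N] [Module R N]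
  {P : RootPairing ι R M N} [P.IsCrystallographic]

omit [Fintype ι] [CharZero R] [P.IsCrystallographic] in
theorem weylGroupToPerm_ofIdx (i j : ι) :
    P.weylGroupToPerm (RootPairing.weylGroup.ofIdx P i) j = P.reflectionPerm i j := rfl

omit [Fintype ι] [CharZero R] [P.IsCrystallographic] in
theorem weylGroup_forall_perm {p : Equiv.Perm ι → Prop} (h1 : p 1)
    (hmul : ∀ i g, p g → p (P.reflectionPerm i * g)) (w : P.weylGroup) :
    p (P.weylGroupToPerm w) := by
  have key : ∀ w : P.weylGroup, ∀ g, p g → p (P.weylGroupToPerm w * g) := by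
    rintro ⟨w, hw⟩
    induction hw using RootPairing.weylGroup.induction with
    | mem i => exact hmul i
    | one => intro g hg; exact hg
    | mul x y hx hy ihx ihy =>
      intro g hg
      have := ihx _ (ihy g hg)
      rwa [← mul_assoc, ← map_mul] at this
  simpa using key w 1 h1

omit [Fintype ι] in
theorem pairingIn_reflectionPerm_reflectionPerm (k i j : ι) :
    P.pairingIn ℤ (P.reflectionPerm k i) (P.reflectionPerm k j) = P.pairingIn ℤ i j := by
  apply FaithfulSMul.algebraMap_injective ℤ R
  simp only [P.algebraMap_pairingIn, P.pairing_reflectionPerm, P.reflectionPerm_self]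

theorem chainBotCoeff_reflectionPerm_reflectionPerm (k i j : ι) :
    P.chainBotCoeff (P.reflectionPerm k i) (P.reflectionPerm k j) = P.chainBotCoeff i j := by
  have hli : LinearIndependent R ![P.root (P.reflectionPerm k i), P.root (P.reflectionPerm k j)] ↔
      LinearIndependent R ![P.root i, P.root j] := by
    rw [← LinearMap.linearIndependent_iff_of_injOn (f := (P.reflection k).toLinearMap)
      (v := ![P.root i, P.root j]) (P.reflection k).injective.injOn, P.root_reflectionPerm,
      P.root_reflectionPerm]
    congr! 1
    ext x
    fin_cases x <;> rfl
  by_cases h : LinearIndependent R ![P.root i, P.root j]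
  · refine eq_of_forall_le_iff fun n => ?_
    rw [← P.root_sub_nsmul_mem_range_iff_le_chainBotCoeff (hli.mpr h),
      ← P.root_sub_nsmul_mem_range_iff_le_chainBotCoeff h, P.root_reflectionPerm,
      P.root_reflectionPerm, ← map_nsmul, ← map_sub]
    constructor
    · rintro ⟨l, hl⟩
      exact ⟨P.reflectionPerm k l, by rw [P.root_reflectionPerm, hl, P.reflection_same]⟩
    · rintro ⟨l, hl⟩
      exact ⟨P.reflectionPerm k l, by rw [P.root_reflectionPerm, hl]⟩
  · rw [RootPairing.chainBotCoeff_of_not_linearIndependent h,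
      RootPairing.chainBotCoeff_of_not_linearIndependent (hli.not.mpr h)]

theorem term_weylGroupToPerm (w : P.weylGroup) (i j : ι) :
    term P (P.weylGroupToPerm w i) (P.weylGroupToPerm w j) = term P i j := by
  refine weylGroup_forall_perm (p := fun g => term P (g i) (g j) = term P i j) rfl
    (fun k g hg => ?_) w
  rw [← hg]
  simp only [term, Equiv.Perm.mul_apply, pairingIn_reflectionPerm_reflectionPerm,
    chainBotCoeff_reflectionPerm_reflectionPerm]

omit [Fintype ι] [CharZero R] [P.IsCrystallographic] in
theorem ofIdx_mul_self (i : ι) :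
    RootPairing.weylGroup.ofIdx P i * RootPairing.weylGroup.ofIdx P i = 1 := by
  apply Subtype.ext
  apply RootPairing.Equiv.weightHom_injective P
  ext x
  exact P.reflection_same i x

omit [Fintype ι] [CharZero R] [P.IsCrystallographic] in
theorem ofIdx_reflectionPerm (i j : ι) : RootPairing.weylGroup.ofIdx P (P.reflectionPerm j i) =
    RootPairing.weylGroup.ofIdx P j * RootPairing.weylGroup.ofIdx P i *
      RootPairing.weylGroup.ofIdx P j := by
  apply Subtype.ext
  apply RootPairing.Equiv.weightHom_injective P
  ext x
  change P.reflection (P.reflectionPerm j i) x = P.reflection j (P.reflection i (P.reflection j x))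
  rw [P.reflection_reflectionPerm]
  rfl

omit [Fintype ι] [CharZero R] [P.IsCrystallographic] in
theorem wordProd_cons (b : P.Base) (i : b.support) (l : List b.support) :
    wordProd b (i :: l) = RootPairing.weylGroup.ofIdx P i.1 * wordProd b l := rfl

variable [P.IsReduced] (b : P.Base)

omit [Fintype ι] [P.IsReduced] in
theorem height_reflectionPerm {i : ι} (hi : i ∈ b.support) (j : ι) :
    b.height (P.reflectionPerm i j) = b.height j - P.pairingIn ℤ j i := by
  have : P.root (P.reflectionPerm i j) = P.root j + (-P.pairingIn ℤ j i) • P.root i := by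
    rw [P.root_reflectionPerm, neg_smul, P.reflection_apply_root' ℤ, sub_eq_add_neg]
  rw [b.height_add_zsmul this, b.height_one_of_mem_support hi]
  simp [sub_eq_add_neg]

/-- The exchange property. -/
theorem exists_shorter_word (l : List b.support) : ∀ γ : ι, b.IsPos γ →
    ¬ b.IsPos ((P.weylGroupToPerm (wordProd b l))⁻¹ γ) → ∃ l' : List b.support,
      l'.length + 1 = l.length ∧ wordProd b l' = RootPairing.weylGroup.ofIdx P γ * wordProd b l := by
  induction l with
  | nil => intro γ hγ h; simp [wordProd, hγ] at h
  | cons j t ih =>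
    intro γ hγ h
    by_cases hj : γ = j
    · subst hj
      exact ⟨t, rfl, by rw [wordProd_cons, ← mul_assoc, ofIdx_mul_self, one_mul]⟩
    -- The simple reflection `s_j` keeps every positive root other than `α_j` positive, so the
    -- induction hypothesis applies to `s_j γ`. Conjugating by `s_j` turns its reflection back into
    -- that of `γ`.
    · have hpos := hγ.reflectionPerm j.2 hj
      have hneg : ¬ b.IsPos ((P.weylGroupToPerm (wordProd b t))⁻¹ (P.reflectionPerm j γ)) := by
        rw [wordProd_cons, map_mul, mul_inv_rev, Equiv.Perm.mul_apply] at h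
        have : (P.weylGroupToPerm (RootPairing.weylGroup.ofIdx P j.1))⁻¹ = P.reflectionPerm j :=
          P.reflectionPerm_inv j
        rwa [this] at h
      obtain ⟨l', hl', hw⟩ := ih _ hpos hneg
      refine ⟨j :: l', by simp [hl'], ?_⟩
      rw [wordProd_cons, hw, ofIdx_reflectionPerm, wordProd_cons]
      simp only [← mul_assoc]
      rw [ofIdx_mul_self, one_mul]

/-- A word in the simple reflections is reduced if it has minimal length among the words with the
same product. -/
def IsReducedWord (b : P.Base) (l : List b.support) : Prop :=
  ∀ l' : List b.support, wordProd b l' = wordProd b l → l.length ≤ l'.length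

omit [Fintype ι] [CharZero R] [P.IsCrystallographic] [P.IsReduced] in
theorem IsReducedWord.tail {b : P.Base} {i : b.support} {l : List b.support}
    (h : IsReducedWord b (i :: l)) : IsReducedWord b l := by
  intro l' hl'
  simpa using h (i :: l') (by rw [wordProd_cons, wordProd_cons, hl'])

/-- Otherwise the exchange property would write `s_i w` with fewer letters than `l`. -/
theorem IsReducedWord.isPos {b : P.Base} {i : b.support} {l : List b.support}
    (h : IsReducedWord b (i :: l)) : b.IsPos ((P.weylGroupToPerm (wordProd b l))⁻¹ i) := by
  by_contra hneg
  obtain ⟨l', hl', hw⟩ := exists_shorter_word b l i (b.isPos_of_mem_support i.2) hneg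
  have := h l' hw
  simp only [List.length_cons] at this
  omega

theorem wordProd_reducedWord (w : P.weylGroup) : wordProd b (reducedWord b w) = w :=
  (exists_reducedWord b w).choose_spec.1

theorem isReducedWord_reducedWord (w : P.weylGroup) : IsReducedWord b (reducedWord b w) := by
  intro l' hl'
  rw [wordProd_reducedWord] at hl'
  exact (exists_reducedWord b w).choose_spec.2 l' hl'

omit [Fintype ι] [P.IsCrystallographic] [P.IsReduced] in
theorem not_isPos_reflectionPerm_self {i : ι} (hi : b.IsPos i) :
    ¬ b.IsPos (P.reflectionPerm i i) := by
  have := b.height_reflectionPerm_self i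
  change b.height (P.reflectionPerm i i) = _ at this
  rw [RootPairing.Base.isPos_iff] at hi ⊢
  omega

/-- Because `s_i` permutes the positive roots other than `α_i`, left multiplication by `s_i` changes
the sign of `wγ` only for `wγ = ±α_i`. The positive `γ` among these is `w⁻¹ α_i`. -/
theorem inversions_ofIdx_mul [DecidableEq ι] {i : ι} (hi : i ∈ b.support) {w : P.weylGroup}
    (hw : b.IsPos ((P.weylGroupToPerm w)⁻¹ i)) :
    inversions b (RootPairing.weylGroup.ofIdx P i * w) =
      insert ((P.weylGroupToPerm w)⁻¹ i) (inversions b w) := by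
  ext γ
  simp only [inversions, Finset.mem_filter, Finset.mem_univ, true_and, Finset.mem_insert, map_mul,
    Equiv.Perm.mul_apply, weylGroupToPerm_ofIdx, Equiv.Perm.eq_inv_iff_eq]
  constructor
  · rintro ⟨h1, h2⟩
    by_cases h : P.weylGroupToPerm w γ = i
    · exact Or.inl h
    · refine Or.inr ⟨h1, fun h3 => h2 (h3.reflectionPerm hi h)⟩
  · rintro (h | ⟨h1, h2⟩)
    · refine ⟨?_, ?_⟩
      · rwa [← Equiv.Perm.eq_inv_iff_eq.mpr h] at hw
      · rw [h]; exact not_isPos_reflectionPerm_self b (b.isPos_of_mem_support hi)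
    · refine ⟨h1, fun h3 => ?_⟩
      have hne : P.reflectionPerm i (P.weylGroupToPerm w γ) ≠ i := by
        intro h
        have h4 : P.weylGroupToPerm w γ = P.reflectionPerm i i := by
          apply (P.reflectionPerm i).injective
          rw [h, P.reflectionPerm_self]
        have h5 : γ = (P.weylGroupToPerm w)⁻¹ (P.reflectionPerm i i) := by
          rw [Equiv.Perm.eq_inv_iff_eq, h4]
        have hn : P.root ((P.weylGroupToPerm w)⁻¹ (P.reflectionPerm i i)) =
            - P.root ((P.weylGroupToPerm w)⁻¹ i) := by
          rw [← map_inv, ← P.weylGroup_apply_root, ← P.weylGroup_apply_root, P.root_reflectionPerm,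
            P.reflection_apply_self, smul_neg]
        have hn' : γ = P.reflectionPerm ((P.weylGroupToPerm w)⁻¹ i) ((P.weylGroupToPerm w)⁻¹ i) := by
          apply P.root.injective
          rw [h5, hn, P.root_reflectionPerm, P.reflection_apply_self]
        rw [hn'] at h1
        exact not_isPos_reflectionPerm_self b hw h1
      have := h3.reflectionPerm hi hne
      rw [P.reflectionPerm_self] at this
      exact h2 this

/-- The new inversion `w⁻¹ α_i` contributes `⟪β, w⁻¹ α_i⟫`, which is `⟪wβ, α_i⟫` by Weyl invariance
of `term`. -/
theorem kottwitzExponent_cons {i : b.support} {l : List b.support}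
    (h : IsReducedWord b (i :: l)) (β : ι) :
    kottwitzExponent b (wordProd b (i :: l)) β =
      kottwitzExponent b (wordProd b l) β + term P (P.weylGroupToPerm (wordProd b l) β) i := by
  classical
  have hnot : (P.weylGroupToPerm (wordProd b l))⁻¹ i ∉ inversions b (wordProd b l) := by
    simp [inversions, b.isPos_of_mem_support i.2]
  rw [kottwitzExponent, kottwitzExponent, wordProd_cons, inversions_ofIdx_mul b i.2 h.isPos,
    Finset.sum_insert hnot, add_comm]
  congr 1
  rw [← term_weylGroupToPerm (wordProd b l)]
  congr 1
  exact (P.weylGroupToPerm (wordProd b l)).apply_symm_apply i.1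

omit [P.IsReduced] in
theorem kottwitzExponent_nil (β : ι) : kottwitzExponent b (wordProd b []) β = 0 := by
  rw [kottwitzExponent, Finset.sum_eq_zero]
  intro γ hγ
  simp only [inversions, Finset.mem_filter, Finset.mem_univ, true_and] at hγ
  exact absurd hγ.1 hγ.2

end Words

/-! ### Consequences of positive definiteness on the root lattice -/

section IntegralForm

variable {ι R M N : Type*} [Fintype ι] [Field R] [CharZero R]
  [AddCommGroup M] [Module R M] [AddCommGroup N] [Module R N]
  (P : RootPairing ι R M N) [P.IsCrystallographic]

/-- The canonical positive definite integral form on the root lattice. -/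
def intForm : LinearMap.BilinForm ℤ (P.rootSpan ℤ) := (P.posRootForm ℤ).posForm

/-- The values of the integral form on roots. -/
def rootInner (i j : ι) : ℤ := intForm P (P.rootSpanMem ℤ i) (P.rootSpanMem ℤ j)

variable {P}

theorem intForm_comm (x y : P.rootSpan ℤ) : intForm P x y = intForm P y x :=
  (P.posRootForm ℤ).isSymm_posForm.eq x y

theorem rootInner_comm (i j : ι) : rootInner P i j = rootInner P j i := intForm_comm _ _

theorem cast_rootInner (i j : ι) : (rootInner P i j : R) = P.RootForm (P.root i) (P.root j) :=
  P.algebraMap_posRootForm_posForm ℤ (P.rootSpanMem ℤ i) (P.rootSpanMem ℤ j)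

theorem rootInner_self_pos (i : ι) : 0 < rootInner P i i := (P.posRootForm ℤ).rootLength_pos i

theorem two_mul_rootInner (i j : ι) :
    2 * rootInner P i j = P.pairingIn ℤ i j * rootInner P j j := by
  apply FaithfulSMul.algebraMap_injective ℤ R
  have : 2 * P.RootForm (P.root i) (P.root j) =
      P.pairing i j * P.RootForm (P.root j) (P.root j) :=
    (P.posRootForm ℤ).two_mul_apply_root_root i j
  simp only [map_mul, P.algebraMap_pairingIn]
  simpa [cast_rootInner] using this

theorem eq_zero_of_intForm_nonpos {x : P.rootSpan ℤ} (hx : intForm P x x ≤ 0) : x = 0 := by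
  by_contra h
  exact absurd (P.posRootForm_posForm_pos_of_ne_zero ℤ h) (not_lt.mpr hx)

omit [Fintype ι] in
theorem pairingIn_eq_of_root_eq_add {i j k : ι} (h : P.root k = P.root i + P.root j) (l : ι) :
    P.pairingIn ℤ k l = P.pairingIn ℤ i l + P.pairingIn ℤ j l := by
  apply FaithfulSMul.algebraMap_injective ℤ R
  simp only [map_add, P.algebraMap_pairingIn]
  simp only [← P.root_coroot_eq_pairing, h, map_add, LinearMap.add_apply]

variable {b : P.Base}

theorem pairingIn_nonpos {i j : b.support} (hij : i ≠ j) : P.pairingIn ℤ i j ≤ 0 :=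
  b.pairingIn_le_zero_of_ne (fun h => hij (Subtype.ext h)) i.2 j.2

/-- A root which is strictly dominant for two non-orthogonal simple roots is their sum. -/
theorem root_eq_add_of_pairingIn_pos {i j : b.support} (hij : i ≠ j) {l : ι}
    (hi : 0 < P.pairingIn ℤ l i) (hj : 0 < P.pairingIn ℤ l j) (h : P.pairingIn ℤ i j ≠ 0) :
    P.root l = P.root i + P.root j ∧ P.pairingIn ℤ i j = -1 ∧ P.pairingIn ℤ j i = -1 := by
  have hij' : P.pairingIn ℤ i j < 0 := lt_of_le_of_ne (pairingIn_nonpos hij) h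
  have hji' : P.pairingIn ℤ j i < 0 := P.pairingIn_lt_zero_iff ℤ |>.mp hij'
  have hjl : 0 < P.pairingIn ℤ j l := P.zero_lt_pairingIn_iff' ℤ |>.mp hj
  have e1 := two_mul_rootInner (P := P) i j
  have e2 := two_mul_rootInner (P := P) l i
  have e3 := two_mul_rootInner (P := P) j l
  have pi := rootInner_self_pos (P := P) i
  have pj := rootInner_self_pos (P := P) j
  have pl := rootInner_self_pos (P := P) l
  -- Each of `(α_i, α_j)`, `(α_l, α_i)`, `(α_j, α_l)` is expressed by the squared length of a
  -- different root; the signs of the pairings then make the norm of `α_i + α_j - α_l` nonpositive.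
  have hz : P.rootSpanMem ℤ i + P.rootSpanMem ℤ j - P.rootSpanMem ℤ l = 0 := by
    apply eq_zero_of_intForm_nonpos
    have : intForm P (P.rootSpanMem ℤ i + P.rootSpanMem ℤ j - P.rootSpanMem ℤ l)
        (P.rootSpanMem ℤ i + P.rootSpanMem ℤ j - P.rootSpanMem ℤ l) = rootInner P i i +
          rootInner P j j + rootInner P l l + 2 * rootInner P i j - 2 * rootInner P l i -
          2 * rootInner P j l := by
      simp only [map_add, map_sub, LinearMap.add_apply, LinearMap.sub_apply]
      have a1 := intForm_comm (P.rootSpanMem ℤ i) (P.rootSpanMem ℤ j)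
      have a2 := intForm_comm (P.rootSpanMem ℤ l) (P.rootSpanMem ℤ i)
      have a3 := intForm_comm (P.rootSpanMem ℤ l) (P.rootSpanMem ℤ j)
      simp only [rootInner]
      linarith
    rw [this, e1, e2, e3]
    nlinarith
  have hroot : P.root l = P.root i + P.root j := by
    have := congrArg Subtype.val hz
    rw [eq_comm, ← sub_eq_zero]
    simpa using this
  refine ⟨hroot, ?_, ?_⟩
  · have := pairingIn_eq_of_root_eq_add hroot j
    rw [P.pairingIn_same] at this
    omega
  · have := pairingIn_eq_of_root_eq_add hroot i
    rw [P.pairingIn_same] at this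
    omega

/-- The product of the two pairings is a positive integer. It cannot be 1, since both pairings would
then be `-1` and the lengths equal. -/
theorem rootInner_mul_self_le {i j : b.support} (hij : i ≠ j) (h : P.pairingIn ℤ i j ≠ 0)
    (hne : rootInner P i i ≠ rootInner P j j) :
    rootInner P i j < 0 ∧ rootInner P i i * rootInner P j j ≤ 2 * (rootInner P i j) ^ 2 := by
  have hij' : P.pairingIn ℤ i j < 0 := lt_of_le_of_ne (pairingIn_nonpos hij) h
  have hji' : P.pairingIn ℤ j i < 0 := P.pairingIn_lt_zero_iff ℤ |>.mp hij'
  have e1 := two_mul_rootInner (P := P) i j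
  have e2 := two_mul_rootInner (P := P) j i
  rw [rootInner_comm] at e2
  have pi := rootInner_self_pos (P := P) i
  have pj := rootInner_self_pos (P := P) j
  have h4 : 4 * (rootInner P i j) ^ 2 =
      (P.pairingIn ℤ i j * P.pairingIn ℤ j i) * (rootInner P i i * rootInner P j j) := by
    calc 4 * (rootInner P i j) ^ 2 = (2 * rootInner P i j) * (2 * rootInner P i j) := by ring
      _ = _ := by rw [e2]; nth_rewrite 1 [← e2, e1]; ring
  have h2 : 2 ≤ P.pairingIn ℤ i j * P.pairingIn ℤ j i := by
    by_contra hlt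
    have h1 : P.pairingIn ℤ i j = -1 ∧ P.pairingIn ℤ j i = -1 := by
      constructor <;> nlinarith
    rw [h1.1] at e1
    rw [h1.2] at e2
    apply hne
    linarith
  refine ⟨by nlinarith, ?_⟩
  nlinarith [mul_pos pi pj]

theorem pairingIn_eq_neg_one {i j : b.support} (hij : i ≠ j) (h : P.pairingIn ℤ i j ≠ 0)
    (he : rootInner P i i = rootInner P j j) : P.pairingIn ℤ i j = -1 := by
  have hij' : P.pairingIn ℤ i j < 0 := lt_of_le_of_ne (pairingIn_nonpos hij) h
  have e1 := two_mul_rootInner (P := P) i j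
  have pj := rootInner_self_pos (P := P) j
  have hne : P.rootSpanMem ℤ i + P.rootSpanMem ℤ j ≠ 0 := by
    intro h0
    refine b.root_ne_neg_of_ne i.2 j.2 (fun h => hij (Subtype.ext h)) ?_
    exact eq_neg_of_add_eq_zero_left (by simpa using congrArg Subtype.val h0)
  have hpos : 0 < intForm P (P.rootSpanMem ℤ i + P.rootSpanMem ℤ j)
      (P.rootSpanMem ℤ i + P.rootSpanMem ℤ j) := by
    by_contra hle
    exact hne (eq_zero_of_intForm_nonpos (not_lt.mp hle))
  have : intForm P (P.rootSpanMem ℤ i + P.rootSpanMem ℤ j)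
      (P.rootSpanMem ℤ i + P.rootSpanMem ℤ j) =
      rootInner P i i + rootInner P j j + 2 * rootInner P i j := by
    simp only [map_add, LinearMap.add_apply]
    have a1 := intForm_comm (P.rootSpanMem ℤ i) (P.rootSpanMem ℤ j)
    simp only [rootInner]
    linarith
  rw [this, he, e1] at hpos
  have : -2 < P.pairingIn ℤ i j := by nlinarith
  omega

/-- Two bonds joining simple roots of different lengths cannot be connected by a chain of simple
bonds. -/
theorem false_of_two_multiple_bonds {x y : b.support} {u : ℕ → b.support} {t : ℕ}
    (hu : ∀ k ≤ t, rootInner P (u k) (u k) = rootInner P (u 0) (u 0))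
    (hadj : ∀ k < t, u k ≠ u (k + 1) ∧ P.pairingIn ℤ (u k) (u (k + 1)) ≠ 0)
    (horth : ∀ k l, k + 2 ≤ l → l ≤ t → P.pairingIn ℤ (u k) (u l) = 0)
    (hx : x ≠ u 0 ∧ P.pairingIn ℤ x (u 0) ≠ 0 ∧ rootInner P x x ≠ rootInner P (u 0) (u 0))
    (hx0 : ∀ k, 1 ≤ k → k ≤ t → P.pairingIn ℤ x (u k) = 0)
    (hy : u t ≠ y ∧ P.pairingIn ℤ (u t) y ≠ 0 ∧ rootInner P (u t) (u t) ≠ rootInner P y y)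
    (hy0 : ∀ k < t, P.pairingIn ℤ (u k) y = 0) (hxy : P.pairingIn ℤ x y = 0) : False := by
  have zero_of {i j : ι} (h : P.pairingIn ℤ i j = 0) : rootInner P i j = 0 := by
    have := two_mul_rootInner (P := P) i j
    rw [h, zero_mul] at this
    omega
  set r : ℕ → P.rootSpan ℤ := fun k => P.rootSpanMem ℤ (u k) with hr
  set S : ℕ → P.rootSpan ℤ := fun n => ∑ k ∈ Finset.range (n + 1), r k with hS
  set U := rootInner P (u 0) (u 0) with hU
  -- The chain is contracted to the sum of its roots, which has the same length as each member.
  have hSS : ∀ n ≤ t, intForm P (S n) (S n) = U := by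
    intro n
    induction n with
    | zero => intro _; simp [hS, hr, hU, rootInner]
    | succ n ih =>
      intro hn
      have hcross : 2 * intForm P (S n) (r (n + 1)) = -U := by
        have h1 : intForm P (S n) (r (n + 1)) = rootInner P (u n) (u (n + 1)) := by
          simp only [hS, map_sum, LinearMap.sum_apply]
          rw [Finset.sum_range_succ, Finset.sum_eq_zero, zero_add]
          · rfl
          · intro k hk
            rw [Finset.mem_range] at hk
            exact zero_of (horth k (n + 1) (by omega) hn)
        obtain ⟨h2, h3⟩ := hadj n (by omega)
        rw [h1, two_mul_rootInner, pairingIn_eq_neg_one h2 h3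
          ((hu n (by omega)).trans (hu (n + 1) hn).symm), hu (n + 1) hn]
        ring
      have h4 : S (n + 1) = S n + r (n + 1) := Finset.sum_range_succ _ _
      have h5 : intForm P (r (n + 1)) (r (n + 1)) = U := hu (n + 1) hn
      have h6 := intForm_comm (r (n + 1)) (S n)
      rw [h4]
      simp only [map_add, LinearMap.add_apply]
      rw [ih (by omega), h5, h6]
      linarith
  set X := rootInner P x x
  set Y := rootInner P y y
  have hxS : intForm P (P.rootSpanMem ℤ x) (S t) = rootInner P x (u 0) := by
    simp only [hS, map_sum]
    rw [Finset.sum_range_succ', Finset.sum_eq_zero, zero_add]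
    · rfl
    · intro k hk
      rw [Finset.mem_range] at hk
      exact zero_of (hx0 (k + 1) (by omega) (by omega))
  have hSy : intForm P (S t) (P.rootSpanMem ℤ y) = rootInner P (u t) y := by
    simp only [hS, map_sum, LinearMap.sum_apply]
    rw [Finset.sum_range_succ, Finset.sum_eq_zero, zero_add]
    · rfl
    · intro k hk
      rw [Finset.mem_range] at hk
      exact zero_of (hy0 k hk)
  have hxy' : intForm P (P.rootSpanMem ℤ x) (P.rootSpanMem ℤ y) = 0 := zero_of hxy
  obtain ⟨hq, hq2⟩ := rootInner_mul_self_le hx.1 hx.2.1 hx.2.2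
  obtain ⟨hs, hs2⟩ := rootInner_mul_self_le hy.1 hy.2.1 hy.2.2
  rw [hu t le_rfl] at hs2
  set q := rootInner P x (u 0)
  set s := rootInner P (u t) y
  have hX : 0 < X := rootInner_self_pos _
  have hY : 0 < Y := rootInner_self_pos _
  -- The contracted chain with `x` and `y` has norm `XY (XYU - q²Y - s²X)` in this combination. It
  -- is nonpositive because `XU ≤ 2q²` and `UY ≤ 2s²`.
  have hz : (X * Y) • S t - (q * Y) • P.rootSpanMem ℤ x - (s * X) • P.rootSpanMem ℤ y = 0 := by
    apply eq_zero_of_intForm_nonpos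
    have : intForm P ((X * Y) • S t - (q * Y) • P.rootSpanMem ℤ x - (s * X) • P.rootSpanMem ℤ y)
        ((X * Y) • S t - (q * Y) • P.rootSpanMem ℤ x - (s * X) • P.rootSpanMem ℤ y) =
        X * Y * (X * Y * U - q ^ 2 * Y - s ^ 2 * X) := by
      have a1 : intForm P (S t) (P.rootSpanMem ℤ x) = q := by rw [intForm_comm, hxS]
      have a2 : intForm P (P.rootSpanMem ℤ y) (S t) = s := by rw [intForm_comm, hSy]
      have a3 : intForm P (P.rootSpanMem ℤ y) (P.rootSpanMem ℤ x) = 0 := by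
        rw [intForm_comm, hxy']
      have a4 : intForm P (P.rootSpanMem ℤ x) (P.rootSpanMem ℤ x) = X := rfl
      have a5 : intForm P (P.rootSpanMem ℤ y) (P.rootSpanMem ℤ y) = Y := rfl
      simp only [map_sub, map_smul, LinearMap.sub_apply, LinearMap.smul_apply, smul_eq_mul,
        hSS t le_rfl, hxS, hSy, hxy', a1, a2, a3, a4, a5]
      ring
    rw [this]
    refine mul_nonpos_of_nonneg_of_nonpos (mul_pos hX hY).le ?_
    nlinarith
  -- `φ` sums the coefficients in the simple roots. As `q` and `s` are negative, all coefficients of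
  -- the vanishing vector are positive, a contradiction.
  let φ : P.rootSpan ℤ →ₗ[ℤ] ℤ := b.toWeightBasisInt.constr ℤ fun _ => (1 : ℤ)
  have hφ (i : b.support) : φ (P.rootSpanMem ℤ i) = 1 := by
    have : P.rootSpanMem ℤ i = b.toWeightBasisInt i := by
      apply Subtype.ext
      simp
    rw [this, Basis.constr_basis]
  have hφS : φ (S t) = t + 1 := by
    simp only [hS, map_sum, hr, hφ]
    simp
  have := congrArg φ hz
  simp only [map_sub, map_smul, hφS, hφ, map_zero, smul_eq_mul, mul_one] at this
  have ht : (0 : ℤ) ≤ t := Int.natCast_nonneg t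
  have b1 := mul_pos hX hY
  have b2 := mul_neg_of_neg_of_pos hq hY
  have b3 := mul_neg_of_neg_of_pos hs hX
  nlinarith [mul_nonneg b1.le ht]

end IntegralForm

/-! ### Segments of the Dynkin diagram and Weyl orbits of simple roots -/

section Segments

/-- A repeated vertex or a chord would give a shorter walk. For Dynkin paths this supplies
orthogonality of non-consecutive roots. -/
theorem _root_.SimpleGraph.Walk.getVert_of_length_eq_dist {α : Type*} {G : SimpleGraph α} {u v : α}
    (p : G.Walk u v) (hp : p.length = G.dist u v) {k l : ℕ} (hkl : k + 2 ≤ l) (hl : l ≤ p.length) :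
    p.getVert k ≠ p.getVert l ∧ ¬ G.Adj (p.getVert k) (p.getVert l) := by
  constructor
  · intro h
    have := G.dist_le ((p.take k).append ((p.drop l).copy h.symm rfl))
    rw [SimpleGraph.Walk.length_append, SimpleGraph.Walk.take_length,
      SimpleGraph.Walk.length_copy, SimpleGraph.Walk.drop_length] at this
    omega
  · intro h
    have := G.dist_le ((p.take k).append (SimpleGraph.Walk.cons h (p.drop l)))
    rw [SimpleGraph.Walk.length_append, SimpleGraph.Walk.take_length,
      SimpleGraph.Walk.length_cons, SimpleGraph.Walk.drop_length] at this
    omega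

variable {ι R M N : Type*} [Fintype ι] [Field R] [CharZero R]
  [AddCommGroup M] [Module R M] [AddCommGroup N] [Module R N]
  {P : RootPairing ι R M N} [P.IsCrystallographic] {b : P.Base}

omit [Fintype ι] in
theorem pairingIn_eq_zero_iff_pairing {i j : ι} : P.pairingIn ℤ i j = 0 ↔ P.pairing i j = 0 := by
  rw [← P.algebraMap_pairingIn ℤ, FaithfulSMul.algebraMap_eq_zero_iff]

theorem rootInner_self_eq_iff {i j : ι} : rootInner P i i = rootInner P j j ↔
    P.RootForm (P.root i) (P.root i) = P.RootForm (P.root j) (P.root j) := by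
  rw [← cast_rootInner, ← cast_rootInner, Int.cast_inj]

/-- A shortest path in the Dynkin diagram between simple roots of the same length passes through
roots of this length only. -/
theorem rootInner_getVert_eq {i j : b.support} (p : (dynkin b).Walk i j)
    (hp : p.length = (dynkin b).dist i j) (hij : rootInner P i i = rootInner P j j) :
    ∀ k ≤ p.length, rootInner P (p.getVert k) (p.getVert k) = rootInner P i i := by
  set v := p.getVert
  set ℓ : ℕ → ℤ := fun k => rootInner P (v k) (v k) with hℓ
  have h0 : ℓ 0 = rootInner P i i := by simp [hℓ, v]
  have hn : ℓ p.length = rootInner P i i := by simp [hℓ, v, hij]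
  have hadj (k : ℕ) (hk : k < p.length) : v k ≠ v (k + 1) ∧ P.pairingIn ℤ (v k) (v (k + 1)) ≠ 0 := by
    have := p.adj_getVert_succ hk
    exact ⟨this.1, fun h => this.2 (pairingIn_eq_zero_iff_pairing.mp h)⟩
  have horth (k l : ℕ) (hkl : k + 2 ≤ l) (hl : l ≤ p.length) : P.pairingIn ℤ (v k) (v l) = 0 := by
    obtain ⟨h1, h2⟩ := p.getVert_of_length_eq_dist hp hkl hl
    by_contra h3
    exact h2 ⟨h1, fun h => h3 (pairingIn_eq_zero_iff_pairing.mpr h)⟩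
  by_contra hcon
  classical
  have hex : ∃ k, k ≤ p.length ∧ ℓ k ≠ rootInner P i i := by
    by_contra h
    push Not at h
    exact hcon h
  obtain ⟨hc1, hc2⟩ := Nat.find_spec hex
  have hmin (k : ℕ) (hk : k < Nat.find hex) : ℓ k = rootInner P i i := by
    by_contra h
    exact Nat.find_min hex hk ⟨by omega, h⟩
  set c := Nat.find hex
  have hc0 : c ≠ 0 := fun h => hc2 (by rw [h, h0])
  -- `c` is the first vertex whose length differs from that of `i`, and `m` below is the first later
  -- vertex whose length differs from that of `c`. The vertices `c, …, m - 1` are then a chain of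
  -- equal lengths bounded by two bonds between different lengths.
  have hex2 : ∃ k, c < k ∧ k ≤ p.length ∧ ℓ k ≠ ℓ c := by
    refine ⟨p.length, lt_of_le_of_ne hc1 fun h => hc2 (by rw [h, hn]), le_rfl, ?_⟩
    rw [hn]
    exact Ne.symm hc2
  obtain ⟨hm1, hm2, hm3⟩ := Nat.find_spec hex2
  have hmin2 (k : ℕ) (hk : c ≤ k) (hk' : k < Nat.find hex2) : ℓ k = ℓ c := by
    rcases hk.eq_or_lt with rfl | hlt
    · rfl
    · by_contra h
      exact Nat.find_min hex2 hk' ⟨hlt, by omega, h⟩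
  set m := Nat.find hex2
  clear_value c m
  obtain ⟨a, rfl⟩ := Nat.exists_eq_succ_of_ne_zero hc0
  refine false_of_two_multiple_bonds (x := v a) (y := v m) (u := fun k => v (a + 1 + k))
    (t := m - (a + 2)) (fun k hk => hmin2 (a + 1 + k) (by omega) (by omega))
    (fun k hk => hadj (a + 1 + k) (by omega)) (fun k l hkl hl => horth _ _ (by omega) (by omega))
    ⟨(hadj a (by omega)).1, (hadj a (by omega)).2, ?_⟩
    (fun k hk hk' => horth _ _ (by omega) (by omega)) ?_
    (fun k hk => horth _ _ (by omega) (by omega)) (horth _ _ (by omega) hm2)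
  · intro h
    exact hc2 (h.symm.trans (hmin a (by omega)))
  · have h1 := hadj (m - 1) (by omega)
    have h2 := hmin2 (m - 1) (by omega) (by omega)
    rw [show m - 1 + 1 = m by omega] at h1
    rw [show a + 1 + (m - (a + 2)) = m - 1 by omega]
    exact ⟨h1.1, h1.2, fun h => hm3 (h.symm.trans h2)⟩

/-- Between two simple roots of the same segment there is a chain of simple bonds, of length the
distance in the Dynkin diagram. -/
theorem SameSegment.exists_chain {i j : b.support} (h : SameSegment b i j) :
    ∃ v : ℕ → b.support, v 0 = i ∧ v ((dynkin b).dist i j) = j ∧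
      ∀ k < (dynkin b).dist i j, v k ≠ v (k + 1) ∧ P.pairingIn ℤ (v k) (v (k + 1)) = -1 ∧
        P.pairingIn ℤ (v (k + 1)) (v k) = -1 := by
  obtain ⟨p, hp⟩ := h.1.exists_walk_length_eq_dist
  have hl := rootInner_getVert_eq p hp (rootInner_self_eq_iff.mpr h.2)
  refine ⟨p.getVert, by simp, by rw [← hp]; simp, fun k hk => ?_⟩
  rw [← hp] at hk
  have hadj := p.adj_getVert_succ hk
  have he := (hl k hk.le).trans (hl (k + 1) hk).symm
  exact ⟨hadj.1, pairingIn_eq_neg_one hadj.1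
    (fun h => hadj.2 (pairingIn_eq_zero_iff_pairing.mp h)) he,
    pairingIn_eq_neg_one hadj.1.symm
    (fun h => hadj.symm.2 (pairingIn_eq_zero_iff_pairing.mp h)) he.symm⟩

/-- Simple roots conjugate under the Weyl group are in the same segment. -/
theorem sameSegment_of_weylGroup [P.IsReduced] {w : P.weylGroup} {i j : b.support}
    (h : P.weylGroupToPerm w i = j) : SameSegment b i j := by
  constructor
  · obtain ⟨l, rfl⟩ := exists_word b w
    -- The span of the simple roots in the component of `i` is stable under simple reflections:
    -- those outside the component fix it pointwise. Linear independence of the simple roots then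
    -- places `j` in the component.
    set C : Set b.support := {k | (dynkin b).Reachable i k}
    have key (l : List b.support) : P.root (P.weylGroupToPerm (wordProd b l) i) ∈
        Submodule.span R ((fun k : b.support => P.root k) '' C) := by
      induction l with
      | nil => exact Submodule.subset_span ⟨i, SimpleGraph.Reachable.refl i, by simp [wordProd]⟩
      | cons k l ih =>
        rw [wordProd_cons, map_mul, Equiv.Perm.mul_apply, weylGroupToPerm_ofIdx,
          P.root_reflectionPerm, P.reflection_apply]
        by_cases hk : k ∈ C
        · exact sub_mem ih (Submodule.smul_mem _ _ (Submodule.subset_span ⟨k, hk, rfl⟩))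
        · have : P.coroot' k (P.root (P.weylGroupToPerm (wordProd b l) i)) = 0 := by
            have hle : Submodule.span R ((fun k : b.support => P.root k) '' C) ≤
                LinearMap.ker (P.coroot' k) := by
              rw [Submodule.span_le]
              rintro - ⟨m, hm, rfl⟩
              by_contra h0
              refine hk (hm.trans (SimpleGraph.Adj.reachable ⟨?_, fun h1 => h0 ?_⟩))
              · rintro rfl; exact hk hm
              · simpa using h1
            exact hle ih
          rwa [this, zero_smul, sub_zero]
    have hj := key l
    rw [h] at hj
    have hli : LinearIndependent R fun k : b.support => P.root k := b.linearIndepOn_root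
    by_contra hjC
    exact hli.notMem_span_image (s := C) (x := j) hjC hj
  · rw [← h]
    exact weylGroup_forall_perm (p := fun g => P.RootForm (P.root i) (P.root i) =
      P.RootForm (P.root (g i)) (P.root (g i))) rfl (fun k g hg => by
        rw [hg, Equiv.Perm.mul_apply, P.root_reflectionPerm, P.rootForm_reflection_reflection_apply]) w

omit [Fintype ι] [CharZero R] in
theorem reflectionPerm_reflectionPerm_of_simple_bond {i j : ι} (hij : P.pairingIn ℤ i j = -1)
    (hji : P.pairingIn ℤ j i = -1) : P.reflectionPerm i (P.reflectionPerm j i) = j := by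
  apply P.root.injective
  rw [P.root_reflectionPerm, P.root_reflectionPerm, P.reflection_apply_root' ℤ, hij, map_sub,
    map_zsmul, P.reflection_apply_self, P.reflection_apply_root' ℤ, hji]
  module

/-- Simple roots in the same segment are conjugate under the Weyl group. -/
theorem SameSegment.exists_weylGroup {i j : b.support} (h : SameSegment b i j) :
    ∃ w : P.weylGroup, P.weylGroupToPerm w i = j := by
  obtain ⟨v, h0, hd, hv⟩ := h.exists_chain
  have key (k : ℕ) (hk : k ≤ (dynkin b).dist i j) :
      ∃ w : P.weylGroup, P.weylGroupToPerm w i = v k := by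
    induction k with
    | zero => exact ⟨1, by simp [h0]⟩
    | succ k ih =>
      obtain ⟨w, hw⟩ := ih (by omega)
      obtain ⟨-, h1, h2⟩ := hv k (by omega)
      refine ⟨RootPairing.weylGroup.ofIdx P (v k).1 * (RootPairing.weylGroup.ofIdx P (v (k + 1)).1 * w),
        ?_⟩
      rw [map_mul, map_mul, Equiv.Perm.mul_apply, Equiv.Perm.mul_apply, hw]
      exact reflectionPerm_reflectionPerm_of_simple_bond h1 h2
  rw [← hd]
  exact key _ le_rfl

/-- Every root is conjugate to a special simple root. -/
theorem IsSpecialChoice.exists_weylGroup [P.IsReduced] {sp : b.support → b.support}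
    (hsp : IsSpecialChoice b sp) (l : ι) :
    ∃ (w : P.weylGroup) (i : b.support), P.weylGroupToPerm w (sp i) = l := by
  refine b.induction_reflect l (p := fun l => ∃ (w : P.weylGroup) (i : b.support),
    P.weylGroupToPerm w (sp i) = l) ?_ ?_ ?_
  · rintro k ⟨w, i, hk⟩
    exact ⟨RootPairing.weylGroup.ofIdx P k * w, i, by rw [map_mul, Equiv.Perm.mul_apply, hk]; rfl⟩
  · intro k hk
    obtain ⟨w, hw⟩ := (hsp.sameSegment ⟨k, hk⟩).exists_weylGroup
    refine ⟨w⁻¹, ⟨k, hk⟩, ?_⟩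
    rw [map_inv, Equiv.Perm.inv_eq_iff_eq, hw]
  · rintro k j ⟨w, i, hk⟩ -
    exact ⟨RootPairing.weylGroup.ofIdx P j * w, i, by rw [map_mul, Equiv.Perm.mul_apply, hk]; rfl⟩

theorem IsSpecialChoice.eq_of_weylGroup [P.IsReduced] {sp : b.support → b.support}
    (hsp : IsSpecialChoice b sp) {w w' : P.weylGroup} {i j : b.support}
    (h : P.weylGroupToPerm w (sp i) = P.weylGroupToPerm w' (sp j)) : sp i = sp j := by
  have h1 : SameSegment b (sp i) (sp j) := by
    refine sameSegment_of_weylGroup (w := w'⁻¹ * w) ?_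
    rw [map_mul, map_inv, Equiv.Perm.mul_apply, Equiv.Perm.inv_eq_iff_eq, h]
  have h2 := hsp.sameSegment i
  have h3 := hsp.sameSegment j
  refine hsp.eq_of_sameSegment i j ⟨(h2.1.trans h1.1).trans h3.1.symm, ?_⟩
  rw [h2.2, h1.2, h3.2]

end Segments

/-! ### The `A₂` braid relation on a lowest weight vector -/

section Braid

variable {K L : Type*} [Field K] [CharZero K] [LieRing L] [LieAlgebra K L] [FiniteDimensional K L]
  {V : Type*} [AddCommGroup V] [Module K V] [LieRingModule L V] [LieModule K L V]
  [FiniteDimensional K V] {h e f h' e' f' : L}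

omit [FiniteDimensional K L] in
-- At each of the three stages the vector is killed by the relevant lowering operator, with
-- eigenvalues `-1`, `-2`, `-1`, so `weylOp_apply_lowest` applies with `m = 1, 2, 1`.
theorem weylOp_weylOp_weylOp_lowest (t : IsSl2Triple h e f) (t' : IsSl2Triple h' e' f')
    (hfe' : ⁅f, e'⁆ = 0) (hf'e : ⁅f', e⁆ = 0) (hhe' : ⁅h, e'⁆ = -e') (hh'e : ⁅h', e⁆ = -e) {y : V}
    (hfy : ⁅f, y⁆ = 0) (hf'y : ⁅f', y⁆ = 0) (hhy : ⁅h, y⁆ = -y) (hh'y : ⁅h', y⁆ = -y) :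
    weylOp K V e f (weylOp K V e' f' (weylOp K V e f y)) =
      (2 : K)⁻¹ • ⁅e, ⁅e', ⁅e', ⁅e, y⁆⁆⁆⁆ := by
  have hee : ⁅e', ⁅e', y⁆⁆ = 0 := by
    have := pow_f_eq_zero (K := K) (m := 1) (n := 2) t'.symm (v := y) (by simp [hh'y]) hf'y
      one_lt_two
    simpa [pow_two] using this
  have hfey : ⁅f, ⁅e, y⁆⁆ = y := by
    rw [leibniz_lie f, hfy, lie_f_e t, neg_lie, hhy]; simp
  have hf'ey : ⁅f', ⁅e, y⁆⁆ = 0 := by rw [leibniz_lie f', hf'y, hf'e]; simp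
  have h1 := weylOp_apply_lowest (K := K) (m := 1) t hfy (by simpa using hhy)
  have h2 := weylOp_apply_lowest (K := K) (m := 2) t' hf'ey (by
    rw [leibniz_lie h', hh'y, hh'e, lie_neg, neg_lie]; push_cast; module)
  have h3 := weylOp_apply_lowest (K := K) (m := 1) t (v := ⁅e', ⁅e', ⁅e, y⁆⁆⁆) (by
    rw [leibniz_lie f, leibniz_lie f, hfe', hfey]; simp [hee]) (by
    rw [leibniz_lie h, leibniz_lie h, leibniz_lie h, hhe', hhy, t.lie_h_e_smul K]
    simp only [lie_neg, neg_lie, lie_add, smul_lie, lie_smul]; push_cast; module)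
  simp only [Nat.factorial_one, Nat.factorial_two, Nat.cast_one, inv_one, pow_one, one_smul,
    pow_two, Module.End.mul_apply, toEnd_apply_apply, Nat.cast_ofNat] at h1 h2 h3
  rw [h1, h2, map_smul, h3]

/-- The braid relation of type `A₂`, on vectors of lowest weight of the fundamental
representation whose weight is `-1` on both coroots. -/
theorem weylOp_braid_lowest (t : IsSl2Triple h e f) (t' : IsSl2Triple h' e' f')
    (hfe' : ⁅f, e'⁆ = 0) (hf'e : ⁅f', e⁆ = 0) (hhe' : ⁅h, e'⁆ = -e') (hh'e : ⁅h', e⁆ = -e) {y : V}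
    (hfy : ⁅f, y⁆ = 0) (hf'y : ⁅f', y⁆ = 0) (hhy : ⁅h, y⁆ = -y) (hh'y : ⁅h', y⁆ = -y) :
    weylOp K V e f (weylOp K V e' f' (weylOp K V e f y)) =
      weylOp K V e' f' (weylOp K V e f (weylOp K V e' f' y)) := by
  rw [weylOp_weylOp_weylOp_lowest t t' hfe' hf'e hhe' hh'e hfy hf'y hhy hh'y,
    weylOp_weylOp_weylOp_lowest t' t hf'e hfe' hh'e hhe' hf'y hfy hh'y hhy]
  have hserre {h e f h' e' f' : L} (t : IsSl2Triple h e f) (hfe' : ⁅f, e'⁆ = 0)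
      (hhe' : ⁅h, e'⁆ = -e') : ⁅e, ⁅e, e'⁆⁆ = 0 := by
    have := pow_f_eq_zero (K := K) (V := L) (m := 1) (n := 2) t.symm (v := e') (by simp [hhe']) hfe'
      one_lt_two
    simpa [pow_two] using this
  have hee {h e f : L} (t : IsSl2Triple h e f) (hfy : ⁅f, y⁆ = 0) (hhy : ⁅h, y⁆ = -y) :
      ⁅e, ⁅e, y⁆⁆ = 0 := by
    have := pow_f_eq_zero (K := K) (m := 1) (n := 2) t.symm (v := y) (by simp [hhy]) hfy
      one_lt_two
    simpa [pow_two] using this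
  -- The Serre relation, expanded on a vector. Applied twice, it shows that `e e' e' e y` and `e' e
  -- e e' y` both equal `2 e e' e e' y`.
  have key {e e' : L} {v : V} (hs : ⁅e, ⁅e, e'⁆⁆ = 0) :
      ⁅e, ⁅e, ⁅e', v⁆⁆⁆ + ⁅e', ⁅e, ⁅e, v⁆⁆⁆ = (2 : K) • ⁅e, ⁅e', ⁅e, v⁆⁆⁆ := by
    have : ⁅⁅e, ⁅e, e'⁆⁆, v⁆ = 0 := by rw [hs, zero_lie]
    simp only [lie_lie, lie_sub] at this
    rw [← sub_eq_zero, ← this, two_smul]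
    abel
  have h1 := key (v := ⁅e', y⁆) (hserre (h' := h') (f' := f') t hfe' hhe')
  have h2 := key (v := y) (hserre (h' := h) (f' := f) t' hf'e hh'e)
  rw [hee t' hf'y hh'y] at h1 h2
  simp only [lie_zero, zero_add, add_zero] at h1 h2
  rw [h1, h2, lie_smul]

end Braid

/-! ### Root spaces and Tits' elements -/

section RootVectors

variable {K L : Type*} [Field K] [CharZero K] [LieRing L] [LieAlgebra K L]
  [FiniteDimensional K L] [LieAlgebra.IsKilling K L]
  {H : LieSubalgebra K L} [H.IsCartanSubalgebra] [IsTriangularizable K H L]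

theorem mem_rootSpace_iff {χ : H → K} {x : L} :
    x ∈ rootSpace H χ ↔ ∀ h : H, ⁅(h : L), x⁆ = χ h • x := by
  refine ⟨fun hx h => lie_eq_smul_of_mem_rootSpace hx h, fun hx => ?_⟩
  refine (mem_genWeightSpace L χ x).mpr fun h => ⟨1, ?_⟩
  have : ⁅h, x⁆ = χ h • x := hx h
  simp [this]

theorem exists_root_of_mem_rootSpace {χ : Dual K H} {x : L} (hx : x ∈ rootSpace H χ) (hx0 : x ≠ 0)
    (hχ : χ ≠ 0) : χ ∈ Set.range (rootSystem H).root := by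
  let w : Weight K H L := ⟨χ, fun h => hx0 (by simpa [h] using hx)⟩
  refine ⟨⟨w, ?_⟩, ?_⟩
  · simp only [LieSubalgebra.root, Finset.mem_filter, Finset.mem_univ, true_and]
    intro h0
    exact hχ (LinearMap.ext fun h => congrFun h0 h)
  · ext h; rfl

theorem lie_eq_zero_of_add_notMem_range {χ ψ : Dual K H} {x y : L} (hx : x ∈ rootSpace H χ)
    (hy : y ∈ rootSpace H ψ) (h0 : χ + ψ ≠ 0) (h : χ + ψ ∉ Set.range (rootSystem H).root) :
    ⁅x, y⁆ = 0 := by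
  by_contra hxy
  exact h (exists_root_of_mem_rootSpace (χ := χ + ψ)
    (lie_mem_genWeightSpace_of_mem_genWeightSpace hx hy) hxy h0)

theorem lie_coroot_eq {α β : H.root} {x : L} (hx : x ∈ rootSpace H β.1) :
    ⁅(coroot α.1 : L), x⁆ = ((rootSystem H).pairingIn ℤ β α : K) • x := by
  rw [mem_rootSpace_iff.mp hx]
  congr 1
  exact ((rootSystem H).algebraMap_pairingIn ℤ β α).symm

theorem exists_smul_eq_of_mem_rootSpace {α : H.root} {x y : L} (hx : x ∈ rootSpace H α.1)
    (hx0 : x ≠ 0) (hy : y ∈ rootSpace H α.1) : ∃ c : K, c • x = y := by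
  obtain ⟨c, hc⟩ := (finrank_eq_one_iff_of_nonzero' (⟨x, hx⟩ : rootSpace H α.1)
    (fun h0 => hx0 (congrArg Subtype.val h0))).mp
    (finrank_rootSpace_eq_one α.1 (H.isNonZero_coe_root α)) ⟨y, hy⟩
  exact ⟨c, congrArg Subtype.val hc⟩

theorem opposite_spec (α : H.root) {x : L} (hx : x ∈ rootSpace H α.1) (hx0 : x ≠ 0) :
    opposite α x ∈ rootSpace H (-α.1) ∧ ⁅x, opposite α x⁆ = -(coroot α.1 : L) := by
  have h := (existsUnique_opposite α x hx hx0).exists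
  rw [opposite, dif_pos h]
  exact h.choose_spec

theorem opposite_neg (α : H.root) {x : L} (hx : x ∈ rootSpace H α.1) (hx0 : x ≠ 0) :
    opposite α (-x) = -opposite α x := by
  have h1 := opposite_spec α hx hx0
  refine (existsUnique_opposite α (-x) (neg_mem hx) (neg_ne_zero.mpr hx0)).unique
    (opposite_spec α (neg_mem hx) (neg_ne_zero.mpr hx0)) ⟨neg_mem h1.1, ?_⟩
  rw [neg_lie, lie_neg, neg_neg, h1.2]

theorem isSl2Triple_opposite (α : H.root) {x : L} (hx : x ∈ rootSpace H α.1) (hx0 : x ≠ 0) :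
    IsSl2Triple (coroot α.1 : L) x (-opposite α x) := by
  obtain ⟨h1, h2⟩ := opposite_spec α hx hx0
  have h3 := root_apply_coroot (H.isNonZero_coe_root α)
  refine ⟨?_, by rw [lie_neg, h2, neg_neg], ?_, ?_⟩
  · rw [Ne, ZeroMemClass.coe_eq_zero, coroot_eq_zero_iff]
    exact H.isNonZero_coe_root α
  · rw [mem_rootSpace_iff.mp hx, h3, two_smul, two_nsmul]
  · rw [lie_neg, mem_rootSpace_iff.mp h1, Pi.neg_apply, h3, neg_smul, two_smul, two_nsmul]
    abel

omit [IsTriangularizable K H L] in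
theorem titsElement_eq_weylOp (V : Type*) [AddCommGroup V] [Module K V] [LieRingModule L V]
    [LieModule K L V] (α : H.root) (x : L) :
    titsElement V α x = weylOp K V x (-opposite α x) := by
  rw [titsElement, weylOp, neg_neg]

/-- Split `h` into a part `g` in the kernel of `α` and a multiple of the coroot. Tits' element
commutes with `g` and negates the coroot, which is the effect of the reflection on weights. -/
theorem titsElement_mem_rootSpace {α β : H.root} {x y : L} (hx : x ∈ rootSpace H α.1) (hx0 : x ≠ 0)
    (hy : y ∈ rootSpace H β.1) :
    titsElement L α x y ∈ rootSpace H ((rootSystem H).reflectionPerm α β).1 := by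
  have t := isSl2Triple_opposite α hx hx0
  rw [titsElement_eq_weylOp]
  rw [mem_rootSpace_iff] at hy ⊢
  intro h
  have h2 := root_apply_coroot (H.isNonZero_coe_root α)
  have hrefl : ((rootSystem H).reflectionPerm α β).1 h = β.1 h - β.1 (coroot α.1) * α.1 h :=
    DFunLike.congr_fun ((rootSystem H).root_reflectionPerm α β) h
  set g : H := h - (α.1 h / 2) • coroot α.1 with hg
  have hαg : α.1 g = 0 := by
    rw [hg, ← Weight.toLinear_apply, map_sub, map_smul, Weight.toLinear_apply,
      Weight.toLinear_apply, h2, smul_eq_mul, div_mul_cancel₀ _ two_ne_zero, sub_self]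
  have hβg : β.1 g = β.1 h - α.1 h / 2 * β.1 (coroot α.1) := by
    rw [hg, ← Weight.toLinear_apply, map_sub, map_smul]; rfl
  have hc := commute_weylOp (K := K) (V := L) t (x := (g : L))
    (by rw [← lie_skew, mem_rootSpace_iff.mp hx, hαg, zero_smul, neg_zero])
    (by rw [← lie_skew, mem_rootSpace_iff.mp (neg_mem (opposite_spec α hx hx0).1), Pi.neg_apply,
      hαg, neg_zero, zero_smul, neg_zero])
  have hc' : ⁅(g : L), weylOp K L x (-opposite α x) y⁆ = β.1 g • weylOp K L x (-opposite α x) y := by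
    have := LinearMap.congr_fun hc y
    simp only [Module.End.mul_apply, toEnd_apply_apply, hy, map_smul] at this
    exact this.symm
  have hcor := lie_h_weylOp (K := K) t (hy (coroot α.1))
  have hh : (h : L) = (g : L) + (α.1 h / 2) • (coroot α.1 : L) := by
    rw [hg]; simp
  rw [hh, add_lie, smul_lie, hc', hcor, hβg, hrefl, smul_smul, ← add_smul]
  congr 1
  ring

theorem titsElement_ne_zero {α : H.root} {x y : L} (hx : x ∈ rootSpace H α.1) (hx0 : x ≠ 0)
    (hy0 : y ≠ 0) : titsElement L α x y ≠ 0 := by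
  intro h0
  have := LinearMap.congr_fun (weylOp_neg_mul_weylOp (K := K) (V := L)
    (isSl2Triple_opposite α hx hx0)) y
  rw [Module.End.mul_apply, ← titsElement_eq_weylOp, h0, map_zero, Module.End.one_apply] at this
  exact hy0 this.symm

end RootVectors

/-! ### Reflections in two simple roots -/

section Rank2

variable {ι R M N : Type*} [Field R] [CharZero R] [AddCommGroup M] [Module R M] [AddCommGroup N]
  [Module R N] {P : RootPairing ι R M N} [P.IsCrystallographic]

omit [CharZero R] in
theorem root_reflectionPerm_eq (i μ : ι) :
    P.root (P.reflectionPerm i μ) = (1 : ℤ) • P.root μ + (-P.pairingIn ℤ μ i) • P.root i := by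
  rw [P.root_reflectionPerm, P.reflection_apply_root' ℤ]; module

theorem pairingIn_reflectionPerm_left (i j μ : ι) : P.pairingIn ℤ (P.reflectionPerm i μ) j =
    P.pairingIn ℤ μ j - P.pairingIn ℤ μ i * P.pairingIn ℤ i j := by
  rw [P.pairingIn_eq_add_of_root_eq_smul_add_smul (S := ℤ) (root_reflectionPerm_eq i μ)]
  simp only [smul_eq_mul]; ring

theorem reflectionPerm_comm_of_pairingIn_eq_zero {i j : ι} (h : P.pairingIn ℤ i j = 0) (μ : ι) :
    P.reflectionPerm j (P.reflectionPerm i μ) = P.reflectionPerm i (P.reflectionPerm j μ) := by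
  have h' : P.pairingIn ℤ j i = 0 := P.pairingIn_eq_zero_iff.mp h
  apply P.root.injective
  simp only [root_reflectionPerm_eq, pairingIn_reflectionPerm_left, h, h']
  module

/-- The positivity of the pairings says that each reflection in the chain lowers the height, so the
induction hypothesis of `exists_rootVectors` can be used at every stage down to `-μ`. -/
theorem root_reflectionPerm_longest {i j μ : ι} (hμ : P.root μ = P.root i + P.root j)
    (h : P.pairingIn ℤ i j = -1) (h' : P.pairingIn ℤ j i = -1) :
    0 < P.pairingIn ℤ (P.reflectionPerm i μ) j ∧
      0 < P.pairingIn ℤ (P.reflectionPerm j (P.reflectionPerm i μ)) i ∧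
      P.root (P.reflectionPerm i (P.reflectionPerm j (P.reflectionPerm i μ))) =
        -(P.root i + P.root j) := by
  have h2 : P.root μ = (1 : ℤ) • P.root i + (1 : ℤ) • P.root j := by rw [hμ]; module
  simp only [root_reflectionPerm_eq, pairingIn_reflectionPerm_left,
    P.pairingIn_eq_add_of_root_eq_smul_add_smul (S := ℤ) h2, h, h', P.pairingIn_same]
  norm_num
  rw [hμ]
  module

end Rank2

/-! ### Construction of the compatible root vectors -/

section Family

variable {K L : Type*} [Field K] [CharZero K] [LieRing L] [LieAlgebra K L]
  [FiniteDimensional K L] [LieAlgebra.IsKilling K L]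
  {H : LieSubalgebra K L} [H.IsCartanSubalgebra] [IsTriangularizable K H L]
  {b : (rootSystem H).Base} {e : ∀ i : b.support, rootSpace H i.1.1}

omit [CharZero K] [FiniteDimensional K L] [LieAlgebra.IsKilling K L]
  [IsTriangularizable K H L] in
theorem coe_ne_zero {χ : H → K} {x : rootSpace H χ} (hx : x ≠ 0) : (x : L) ≠ 0 :=
  fun h => hx (Subtype.ext h)

/-- Zero is adjoined to the roots because a bracket landing in the zero weight space need not
vanish. -/
theorem reflection_mem_insert_zero_range {x : Dual K H} (i : H.root)
    (hx : x ∈ insert 0 (Set.range (rootSystem H).root)) :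
    (rootSystem H).reflection i x ∈ insert 0 (Set.range (rootSystem H).root) := by
  rcases hx with rfl | ⟨j, rfl⟩
  · left; simp
  · right; exact ⟨_, (rootSystem H).root_reflectionPerm i j⟩

theorem neg_mem_insert_zero_range {x : Dual K H}
    (hx : x ∈ insert 0 (Set.range (rootSystem H).root)) :
    -x ∈ insert 0 (Set.range (rootSystem H).root) := by
  rcases hx with rfl | hx
  · left; simp
  · right; exact (rootSystem H).neg_mem_range_root_iff.mpr hx

theorem lie_eq_zero_of_notMem {χ ψ : Dual K H} {x y : L} (hx : x ∈ rootSpace H χ)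
    (hy : y ∈ rootSpace H ψ) (h : χ + ψ ∉ insert 0 (Set.range (rootSystem H).root)) :
    ⁅x, y⁆ = 0 :=
  lie_eq_zero_of_add_notMem_range hx hy (fun h0 => h (Or.inl h0)) fun h0 => h (Or.inr h0)

theorem sub_notMem_insert_zero_range {i j : b.support} (hij : i ≠ j) :
    (rootSystem H).root i - (rootSystem H).root j ∉
      insert 0 (Set.range (rootSystem H).root) := by
  rintro (h | h)
  · exact hij (Subtype.ext ((rootSystem H).root.injective (sub_eq_zero.mp h)))
  · exact b.sub_notMem_range_root i.2 j.2 h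

/-- Reflection in `α_j` would turn `α_i + α_j` into `α_i - α_j`, a difference of distinct simple
roots. -/
theorem add_notMem_insert_zero_range {i j : b.support} (hij : i ≠ j)
    (h : (rootSystem H).pairingIn ℤ i j = 0) :
    (rootSystem H).root i + (rootSystem H).root j ∉
      insert 0 (Set.range (rootSystem H).root) := by
  intro h0
  refine sub_notMem_insert_zero_range hij ?_
  have := reflection_mem_insert_zero_range j.1 h0
  rwa [map_add, (rootSystem H).reflection_apply_root' ℤ, h, RootPairing.reflection_apply_self,
    zero_smul, sub_zero, ← sub_eq_add_neg] at this

theorem opposite_mem (he : ∀ i, e i ≠ 0) (i : b.support) :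
    -opposite i.1 (e i : L) ∈ rootSpace H (-(rootSystem H).root i : Dual K H) :=
  neg_mem (opposite_spec i.1 (e i).2 (coe_ne_zero (he i))).1

theorem lie_opposite_frame (he : ∀ i, e i ≠ 0) {i j : b.support} (hij : i ≠ j) :
    ⁅-opposite i.1 (e i : L), (e j : L)⁆ = 0 := by
  refine lie_eq_zero_of_notMem (ψ := (rootSystem H).root j) (opposite_mem he i) (e j).2 ?_
  rw [neg_add_eq_sub]
  exact sub_notMem_insert_zero_range hij.symm

theorem isSl2Triple_frame (he : ∀ i, e i ≠ 0) (i : b.support) :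
    IsSl2Triple (coroot i.1.1 : L) (e i : L) (-opposite i.1 (e i : L)) :=
  isSl2Triple_opposite i.1 (e i).2 (coe_ne_zero (he i))

theorem commute_titsElement (V : Type*) [AddCommGroup V] [Module K V] [LieRingModule L V]
    [LieModule K L V] [FiniteDimensional K V] (he : ∀ i, e i ≠ 0) {i j : b.support} (hij : i ≠ j)
    (h : (rootSystem H).pairingIn ℤ i j = 0) :
    Commute (titsElement V i.1 (e i : L)) (titsElement V j.1 (e j : L)) := by
  rw [titsElement_eq_weylOp, titsElement_eq_weylOp]
  have hadd := add_notMem_insert_zero_range hij h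
  refine commute_weylOp_weylOp (isSl2Triple_frame he i) (isSl2Triple_frame he j) ?_
    (lie_opposite_frame he hij) ?_ ?_
  · exact lie_eq_zero_of_notMem (χ := (rootSystem H).root i) (ψ := (rootSystem H).root j)
      (e i).2 (e j).2 hadd
  · rw [← lie_skew, lie_opposite_frame he hij.symm, neg_zero]
  · refine lie_eq_zero_of_notMem (opposite_mem he i) (opposite_mem he j) fun h0 => hadd ?_
    simpa [add_comm] using neg_mem_insert_zero_range h0

theorem titsElement_braid_lowest (he : ∀ i, e i ≠ 0) {i j : b.support} (hij : i ≠ j)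
    (h : (rootSystem H).pairingIn ℤ i j = -1) (h' : (rootSystem H).pairingIn ℤ j i = -1)
    {γ : H.root} (hγ : (rootSystem H).root γ = -((rootSystem H).root i + (rootSystem H).root j))
    {y : L} (hy : y ∈ rootSpace H γ.1) :
    titsElement L i.1 (e i : L) (titsElement L j.1 (e j : L) (titsElement L i.1 (e i : L) y)) =
      titsElement L j.1 (e j : L) (titsElement L i.1 (e i : L)
        (titsElement L j.1 (e j : L) y)) := by
  have aux {i j : b.support} (hij : i ≠ j) (h : (rootSystem H).pairingIn ℤ i j = -1)
      (h' : (rootSystem H).pairingIn ℤ j i = -1)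
      (hγ : (rootSystem H).root γ = -((rootSystem H).root i + (rootSystem H).root j)) :
      ⁅-opposite i.1 (e i : L), y⁆ = 0 ∧ ⁅(coroot i.1.1 : L), y⁆ = -y ∧
        ⁅(coroot i.1.1 : L), (e j : L)⁆ = -(e j : L) := by
    refine ⟨lie_eq_zero_of_notMem (ψ := (rootSystem H).root γ) (opposite_mem he i) hy
      fun h0 => sub_notMem_insert_zero_range hij ?_, ?_, ?_⟩
    · have := reflection_mem_insert_zero_range i.1 h0
      rw [hγ, map_add, map_neg, map_neg, map_add, RootPairing.reflection_apply_self,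
        (rootSystem H).reflection_apply_root' ℤ, h'] at this
      convert this using 1
      module
    · rw [lie_coroot_eq hy]
      have : (rootSystem H).pairingIn ℤ γ i = -1 := by
        have h2 : (rootSystem H).root γ =
            (-1 : ℤ) • (rootSystem H).root i + (-1 : ℤ) • (rootSystem H).root j := by
          rw [hγ]; module
        rw [RootPairing.pairingIn_eq_add_of_root_eq_smul_add_smul (S := ℤ) h2, h',
          RootPairing.pairingIn_same]
        norm_num
      rw [this]; simp
    · rw [lie_coroot_eq (e j).2, h']; simp
  obtain ⟨h1, h2, h3⟩ := aux hij h h' hγ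
  obtain ⟨h4, h5, h6⟩ := aux hij.symm h' h (by rw [hγ, add_comm])
  simp only [titsElement_eq_weylOp]
  exact weylOp_braid_lowest (isSl2Triple_frame he i) (isSl2Triple_frame he j)
    (lie_opposite_frame he hij) (lie_opposite_frame he hij.symm) h3 h6 h1 h4 h2 h5

theorem height_wellFounded (b : (rootSystem H).Base) :
    WellFounded fun μ ν : H.root => b.height μ < b.height ν :=
  @Finite.wellFounded_of_trans_of_irrefl _ _ _ ⟨fun _ _ _ => lt_trans⟩ ⟨fun _ => lt_irrefl _⟩

theorem height_reflectionPerm_lt {μ : H.root} {i : b.support}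
    (h : 0 < (rootSystem H).pairingIn ℤ μ i) :
    b.height ((rootSystem H).reflectionPerm i μ) < b.height μ := by
  rw [height_reflectionPerm b i.2]; omega

/-- Recursion on the height, with one simple root chosen at each stage. Where no simple root pairs
positively, any nonzero root vector serves as the start. -/
theorem exists_rootVectors_aux (e : ∀ i : b.support, rootSpace H i.1.1) (he : ∀ i, e i ≠ 0) :
    ∃ k : H.root → L, (∀ μ, k μ ∈ rootSpace H μ.1 ∧ k μ ≠ 0) ∧
      ∀ μ, (∃ i : b.support, 0 < (rootSystem H).pairingIn ℤ μ i) →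
        ∃ i : b.support, 0 < (rootSystem H).pairingIn ℤ μ i ∧
          k μ = titsElement L i.1 (e i : L) (k ((rootSystem H).reflectionPerm i μ)) := by
  classical
  let F : ∀ μ : H.root, (∀ ν : H.root, b.height ν < b.height μ → L) → L := fun μ r =>
    if h : ∃ i : b.support, 0 < (rootSystem H).pairingIn ℤ μ i then
      titsElement L h.choose.1 (e h.choose : L) (r _ (height_reflectionPerm_lt h.choose_spec))
    else μ.1.exists_ne_zero.choose
  set k := (height_wellFounded b).fix F with hk
  have hfix (μ : H.root) : k μ = F μ fun ν _ => k ν := (height_wellFounded b).fix_eq F μ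
  refine ⟨k, fun μ => ?_, fun μ h => ⟨h.choose, h.choose_spec, ?_⟩⟩
  · induction μ using (height_wellFounded b).induction with
    | _ μ ih =>
      rw [hfix]
      by_cases h : ∃ i : b.support, 0 < (rootSystem H).pairingIn ℤ μ i
      · simp only [F, dif_pos h]
        obtain ⟨h1, h2⟩ := ih _ (height_reflectionPerm_lt h.choose_spec)
        refine ⟨?_, titsElement_ne_zero (e h.choose).2 (coe_ne_zero (he _)) h2⟩
        have := titsElement_mem_rootSpace (e h.choose).2 (coe_ne_zero (he _)) h1
        rwa [(rootSystem H).reflectionPerm_self] at this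
      · simp only [F, dif_neg h]
        exact μ.1.exists_ne_zero.choose_spec
  · rw [hfix]
    simp only [F, dif_pos h]

/-- Root vectors in all root spaces which are compatible with those simple reflections that
decrease the height. -/
theorem exists_rootVectors (e : ∀ i : b.support, rootSpace H i.1.1) (he : ∀ i, e i ≠ 0) :
    ∃ k : H.root → L, (∀ μ, k μ ∈ rootSpace H μ.1 ∧ k μ ≠ 0) ∧
      ∀ (μ : H.root) (i : b.support), 0 < (rootSystem H).pairingIn ℤ μ i →
        k μ = titsElement L i.1 (e i : L) (k ((rootSystem H).reflectionPerm i μ)) := by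
  obtain ⟨k, hk, hk'⟩ := exists_rootVectors_aux e he
  refine ⟨k, hk, fun μ => ?_⟩
  induction μ using (height_wellFounded b).induction with
  | _ μ ih =>
    intro j hj
    obtain ⟨i, hi, hμ⟩ := hk' μ ⟨j, hj⟩
    by_cases hij : i = j
    · rwa [← hij]
    have ihi := ih _ (height_reflectionPerm_lt hi)
    have ihj := ih _ (height_reflectionPerm_lt hj)
    rw [hμ]
    -- Independence of the chosen simple root: both descents are continued until they meet, after
    -- two reflections in the orthogonal case and after three in the `A₂` case.
    by_cases h0 : (rootSystem H).pairingIn ℤ i j = 0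
    · have h0' : (rootSystem H).pairingIn ℤ j i = 0 :=
        (rootSystem H).pairingIn_eq_zero_iff.mp h0
      rw [ihi j (by rw [pairingIn_reflectionPerm_left, h0]; omega),
        ihj i (by rw [pairingIn_reflectionPerm_left, h0']; omega),
        reflectionPerm_comm_of_pairingIn_eq_zero h0]
      exact LinearMap.congr_fun (commute_titsElement L he hij h0) _
    · obtain ⟨hr, h1, h2⟩ := root_eq_add_of_pairingIn_pos hij hi hj h0
      obtain ⟨hij1, hij2, hij3⟩ := root_reflectionPerm_longest hr h1 h2
      obtain ⟨hji1, hji2, hji3⟩ := root_reflectionPerm_longest (hr.trans (add_comm _ _)) h2 h1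
      rw [ihi j hij1, ih _ ((height_reflectionPerm_lt hij1).trans (height_reflectionPerm_lt hi)) i
        hij2, ihj i hji1, ih _ ((height_reflectionPerm_lt hji1).trans (height_reflectionPerm_lt hj))
        j hji2, (rootSystem H).root.injective (hji3.trans (hij3.trans (by rw [add_comm])).symm)]
      exact titsElement_braid_lowest he hij h1 h2 hij3 (hk _).1

end Family

/-! ### Root strings through orthogonal roots -/

section OrthogonalStrings

variable {ι R M N : Type*} [Finite ι] [Field R] [CharZero R] [AddCommGroup M] [Module R M]
  [AddCommGroup N] [Module R N] {P : RootPairing ι R M N} [P.IsCrystallographic] [P.IsReduced]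

/-- Orthogonality makes the string symmetric, and its two coefficients add up to at most 3, so both
are 0 or both are 1. In the second case `k` is the bottom of a three-term string with `j` in the
middle. -/
theorem chainBotCoeff_of_pairingIn_eq_zero {i j : ι} (h : P.pairingIn ℤ j i = 0) :
    (P.chainBotCoeff i j = 0 ∧ P.root i + P.root j ∉ insert 0 (Set.range P.root) ∧
      -P.root i + P.root j ∉ insert 0 (Set.range P.root)) ∨
    (P.chainBotCoeff i j = 1 ∧ ∃ k, P.root i + P.root k = P.root j ∧ P.pairingIn ℤ k i = -2 ∧
      -P.root i + P.root k ∉ insert 0 (Set.range P.root)) := by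
  have hli : LinearIndependent R ![P.root i, P.root j] := by
    rw [P.linearIndependent_iff_coxeterWeightIn_ne_four ℤ, RootPairing.coxeterWeightIn, h, mul_zero]
    norm_num
  have hsub := P.chainBotCoeff_sub_chainTopCoeff hli
  have hle := P.chainBotCoeff_add_chainTopCoeff_le_three (i := i) (j := j)
  rw [h] at hsub
  have hmem (z : ℤ) (hz : ¬ (-(P.chainBotCoeff i j : ℤ) ≤ z ∧ z ≤ P.chainTopCoeff i j)) :
      P.root j + z • P.root i ∉ insert 0 (Set.range P.root) := by
    rintro (h0 | h0)
    · refine one_ne_zero ((LinearIndependent.pair_iff.mp hli) (z : R) 1 ?_).2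
      rw [one_smul, Int.cast_smul_eq_zsmul, add_comm]
      exact h0
    · exact hz ((P.root_add_zsmul_mem_range_iff hli).mp h0)
  obtain hp | hp : P.chainBotCoeff i j = 0 ∨ P.chainBotCoeff i j = 1 := by omega
  · refine Or.inl ⟨hp, ?_, ?_⟩
    · convert hmem 1 (by omega) using 2; module
    · convert hmem (-1) (by omega) using 2; module
  · obtain ⟨k, hk⟩ := (P.root_add_zsmul_mem_range_iff hli (z := -1)).mpr (by simp [hp])
    have hk2 : P.root k = (1 : ℤ) • P.root j + (-1 : ℤ) • P.root i := by rw [hk]; module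
    refine Or.inr ⟨hp, k, by rw [hk]; module, ?_, ?_⟩
    · rw [P.pairingIn_eq_add_of_root_eq_smul_add_smul (S := ℤ) hk2, h, P.pairingIn_same]
      norm_num
    · convert hmem (-2) (by omega) using 2; rw [hk]; module

end OrthogonalStrings

/-! ### Kottwitz' lift permutes the compatible root vectors -/

section Lift

variable {K L : Type*} [Field K] [CharZero K] [LieRing L] [LieAlgebra K L]
  [FiniteDimensional K L] [LieAlgebra.IsKilling K L]
  {H : LieSubalgebra K L} [H.IsCartanSubalgebra] [IsTriangularizable K H L]
  {b : (rootSystem H).Base} {e : ∀ i : b.support, rootSpace H i.1.1}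

/-- Tits' element of a root acts on an orthogonal root space by the sign `(-1)^p`. -/
theorem titsElement_apply_of_pairingIn_eq_zero {α β : H.root} {x y : L}
    (hx : x ∈ rootSpace H α.1) (hx0 : x ≠ 0) (hy : y ∈ rootSpace H β.1)
    (h : (rootSystem H).pairingIn ℤ β α = 0) :
    titsElement L α x y = (((-1 : Kˣ) ^ (rootSystem H).chainBotCoeff α β : Kˣ) : K) • y := by
  have t := isSl2Triple_opposite α hx hx0
  have hf : -opposite α x ∈ rootSpace H (-(rootSystem H).root α : Dual K H) :=
    neg_mem (opposite_spec α hx hx0).1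
  rw [titsElement_eq_weylOp]
  rcases chainBotCoeff_of_pairingIn_eq_zero h with ⟨hp, h1, h2⟩ | ⟨hp, γ, h1, h2, h3⟩
  · rw [hp, pow_zero, Units.val_one, one_smul]
    exact weylOp_apply_of_lie_eq_zero t
      (lie_eq_zero_of_notMem (χ := (rootSystem H).root α) (ψ := (rootSystem H).root β) hx hy h1)
      (lie_eq_zero_of_notMem (ψ := (rootSystem H).root β) hf hy h2)
  · obtain ⟨v, hv, hv0⟩ := γ.1.exists_ne_zero
    have hhv : ⁅(coroot α.1 : L), v⁆ = -(2 : K) • v := by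
      rw [lie_coroot_eq hv, h2]; simp
    have hfv : ⁅-opposite α x, v⁆ = 0 :=
      lie_eq_zero_of_notMem (ψ := (rootSystem H).root γ) hf hv h3
    have hxv0 : ⁅x, v⁆ ≠ 0 := by
      intro h0
      have h1 : ⁅(coroot α.1 : L), v⁆ = 0 := by
        rw [← t.lie_e_f, lie_lie, hfv, h0]; simp
      rw [hhv] at h1
      exact smul_ne_zero (neg_ne_zero.mpr two_ne_zero) hv0 h1
    have hxv : ⁅x, v⁆ ∈ rootSpace H β.1 := by
      have := lie_mem_genWeightSpace_of_mem_genWeightSpace hx hv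
      rwa [show (α.1 + γ.1 : H → K) = β.1 from
        congrArg (fun φ : Dual K H => (φ : H → K)) h1] at this
    obtain ⟨c, rfl⟩ := exists_smul_eq_of_mem_rootSpace hxv hxv0 hy
    rw [map_smul, weylOp_apply_lie_e_of_lowest_two t hfv hhv, hp, pow_one,
      Units.val_neg, Units.val_one, neg_one_smul, smul_neg]

/-- The three cases of `term` are the three signs of the pairing. Negative: compatibility at `s_i
μ`. Zero: the sign `(-1)^p` on an orthogonal root space. Positive: compatibility at `μ` brings in
the square of Tits' element, acting by the parity of the eigenvalue. -/
theorem titsElement_apply_rootVectors (he : ∀ i, e i ≠ 0) {k : H.root → L}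
    (hk : ∀ μ, k μ ∈ rootSpace H μ.1)
    (hk' : ∀ (μ : H.root) (i : b.support), 0 < (rootSystem H).pairingIn ℤ μ i →
        k μ = titsElement L i.1 (e i : L) (k ((rootSystem H).reflectionPerm i μ)))
    (μ : H.root) (i : b.support) :
    titsElement L i.1 (e i : L) (k μ) =
      (((-1 : Kˣ) ^ term (rootSystem H) μ i : Kˣ) : K) • k ((rootSystem H).reflectionPerm i μ) := by
  have hmem := hk μ
  rcases lt_trichotomy ((rootSystem H).pairingIn ℤ μ i) 0 with h | h | h
  · rw [term, if_neg (by omega), if_neg (by omega), zpow_zero, Units.val_one, one_smul,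
      hk' ((rootSystem H).reflectionPerm i μ) i (by rw [pairingIn_reflectionPerm_left, RootPairing.pairingIn_same]; omega),
      (rootSystem H).reflectionPerm_self]
  · have hfix : (rootSystem H).reflectionPerm i μ = μ := by
      apply (rootSystem H).root.injective
      rw [root_reflectionPerm_eq, h]; module
    rw [term, if_neg (by omega), if_pos h, hfix, zpow_natCast,
      titsElement_apply_of_pairingIn_eq_zero (e i).2 (coe_ne_zero (he i)) hmem h]
  · rw [term, if_pos h, hk' μ i h, titsElement_eq_weylOp,
      weylOp_weylOp_apply (n := -(rootSystem H).pairingIn ℤ μ i) (isSl2Triple_frame he i)]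
    · rw [zpow_neg, ← inv_zpow, inv_neg_one]
    · rw [lie_coroot_eq (hk _), pairingIn_reflectionPerm_left, RootPairing.pairingIn_same]
      congr 2
      ring

/-- Kottwitz' lift of a reduced word permutes the compatible root vectors. -/
theorem prod_titsElement_apply (he : ∀ i, e i ≠ 0) {k : H.root → L}
    (hk : ∀ μ, k μ ∈ rootSpace H μ.1)
    (hk' : ∀ (μ : H.root) (i : b.support), 0 < (rootSystem H).pairingIn ℤ μ i →
        k μ = titsElement L i.1 (e i : L) (k ((rootSystem H).reflectionPerm i μ)))
    (μ : H.root) (l : List b.support) (hl : IsReducedWord b l) :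
    (l.map fun i : b.support => titsElement L i.1 (e i : L)).prod (k μ) =
      ((tau b (wordProd b l) μ : Kˣ) : K) • k ((rootSystem H).weylGroupToPerm (wordProd b l) μ) := by
  induction l with
  | nil => rw [tau, kottwitzExponent_nil]; simp [wordProd]
  | cons i l ih =>
    rw [List.map_cons, List.prod_cons, Module.End.mul_apply, ih hl.tail, map_smul,
      titsElement_apply_rootVectors he hk hk', smul_smul, tau, tau, kottwitzExponent_cons b hl,
      zpow_add, Units.val_mul, wordProd_cons, map_mul, Equiv.Perm.mul_apply, weylGroupToPerm_ofIdx]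

/-- The factor `τ_w` cancels exactly the sign that Tits' lift produces. The scalar `c` allows for
frame vectors, which are multiples of the `k μ`. -/
theorem kottwitzLift_apply_rootVectors (he : ∀ i, e i ≠ 0) {k : H.root → L}
    (hk : ∀ μ, k μ ∈ rootSpace H μ.1)
    (hk' : ∀ (μ : H.root) (i : b.support), 0 < (rootSystem H).pairingIn ℤ μ i →
        k μ = titsElement L i.1 (e i : L) (k ((rootSystem H).reflectionPerm i μ)))
    (w : (rootSystem H).weylGroup) (μ : H.root) (x : rootSpace H μ.1) {c : K}
    (hx : c • k μ = x) :
    kottwitzLift b e w μ x = c • k ((rootSystem H).weylGroupToPerm w μ) := by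
  have h := prod_titsElement_apply he hk hk' μ _ (isReducedWord_reducedWord b w)
  rw [wordProd_reducedWord] at h
  have hτ : ((tau b w μ : Kˣ) : K) * ((tau b w μ : Kˣ) : K) = 1 := by
    rw [← Units.val_mul, tau, ← mul_zpow]; simp
  calc titsLift L b e w (((tau b w μ : Kˣ) : K) • (x : L))
      = ((tau b w μ : Kˣ) : K) • c • titsLift L b e w (k μ) := by rw [← hx, map_smul, map_smul]
    _ = ((tau b w μ : Kˣ) : K) • c • ((tau b w μ : Kˣ) : K) •
          k ((rootSystem H).weylGroupToPerm w μ) := by rw [titsLift, h]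
    _ = c • k ((rootSystem H).weylGroupToPerm w μ) := by
      rw [smul_comm c, smul_smul, hτ, one_smul]

end Lift

/-! ### Torus elements, signs along simple bonds, and Kottwitz' family -/

section Splitting

variable {K L : Type*} [Field K] [CharZero K] [LieRing L] [LieAlgebra K L]
  [FiniteDimensional K L] [LieAlgebra.IsKilling K L]
  {H : LieSubalgebra K L} [H.IsCartanSubalgebra] [IsTriangularizable K H L]
  {b : (rootSystem H).Base} {e : ∀ i : b.support, rootSpace H i.1.1}

/-- The integral eigenspaces of the coroot span `V`, so an operator is determined by its values on
them. -/
theorem corootElement_eq {V : Type*} [AddCommGroup V] [Module K V] [LieRingModule L V]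
    [LieModule K L V] [FiniteDimensional K V] {α : H.root} {x : L} (hx : x ∈ rootSpace H α.1)
    (hx0 : x ≠ 0) {c : Kˣ} {T : End K V} (hT : ∀ (n : ℤ) (v : V),
      ⁅(coroot α.1 : L), v⁆ = (n : K) • v → T v = ((c ^ n : Kˣ) : K) • v) :
    corootElement V α c = T := by
  have huniq {T' : End K V} (hT' : ∀ (n : ℤ) (v : V),
      ⁅(coroot α.1 : L), v⁆ = (n : K) • v → T' v = ((c ^ n : Kˣ) : K) • v) : T' = T := by
    have hle : ⨆ n : ℤ, (toEnd K L V (coroot α.1 : L)).eigenspace (n : K) ≤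
        LinearMap.eqLocus T' T := iSup_le fun n v hv => by
      have hv' := Module.End.mem_eigenspace_iff.mp hv
      exact (hT' n v hv').trans (hT n v hv').symm
    rw [iSup_eigenspace_eq_top (isSl2Triple_opposite α hx hx0)] at hle
    exact LinearMap.ext fun v => hle (Submodule.mem_top (x := v))
  have h : ∃! T : End K V, ∀ (n : ℤ) (v : V), ⁅(coroot α.1 : L), v⁆ = (n : K) • v →
      T v = ((c ^ n : Kˣ) : K) • v := ⟨T, hT, fun _ => huniq⟩
  rw [corootElement, dif_pos h]
  exact huniq h.choose_spec.1

theorem corootElement_one {V : Type*} [AddCommGroup V] [Module K V] [LieRingModule L V]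
    [LieModule K L V] [FiniteDimensional K V] {α : H.root} {x : L} (hx : x ∈ rootSpace H α.1)
    (hx0 : x ≠ 0) : corootElement V α 1 = 1 :=
  corootElement_eq hx hx0 fun n v _ => by simp

theorem corootElement_neg_one {V : Type*} [AddCommGroup V] [Module K V] [LieRingModule L V]
    [LieModule K L V] [FiniteDimensional K V] {α : H.root} {x : L} (hx : x ∈ rootSpace H α.1)
    (hx0 : x ≠ 0) : corootElement V α (-1) = titsElement V α x * titsElement V α x :=
  corootElement_eq hx hx0 fun n v hv => by
    rw [titsElement_eq_weylOp]
    exact weylOp_weylOp_apply (isSl2Triple_opposite α hx hx0) hv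

/-- `n(-x)` is inverse to `n(x)`, and its square is `α^∨(-1)`. -/
theorem titsElement_neg {V : Type*} [AddCommGroup V] [Module K V] [LieRingModule L V]
    [LieModule K L V] [FiniteDimensional K V] {α : H.root} {x : L} (hx : x ∈ rootSpace H α.1)
    (hx0 : x ≠ 0) : titsElement V α (-x) = corootElement V α (-1) * titsElement V α x := by
  have t := isSl2Triple_opposite α hx hx0
  have hinv : titsElement V α (-x) * titsElement V α x = 1 := by
    rw [titsElement_eq_weylOp, titsElement_eq_weylOp, opposite_neg α hx hx0]
    exact weylOp_neg_mul_weylOp t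
  have hinv' : titsElement V α x * titsElement V α (-x) = 1 := by
    rw [titsElement_eq_weylOp, titsElement_eq_weylOp, opposite_neg α hx hx0]
    exact weylOp_mul_weylOp_neg t
  have h2 := corootElement_neg_one (V := V) (neg_mem hx) (neg_ne_zero.mpr hx0)
  rw [h2, mul_assoc, hinv, mul_one]

/-- The inner element sends `e_i` to `[e_j, e_i] = -[e_i, e_j]`, and the outer one sends `[e_i,
e_j]` to `-e_j`. -/
theorem titsElement_titsElement_frame (he : ∀ i, e i ≠ 0) {i j : b.support} (hij : i ≠ j)
    (h : (rootSystem H).pairingIn ℤ i j = -1) (h' : (rootSystem H).pairingIn ℤ j i = -1) :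
    titsElement L i.1 (e i : L) (titsElement L j.1 (e j : L) (e i : L)) = e j := by
  have hji := weylOp_apply_lowest (K := K) (m := 1) (isSl2Triple_frame he j)
    (lie_opposite_frame he hij.symm) (by rw [lie_coroot_eq (e i).2, h]; simp)
  have hi := weylOp_apply_lie_e_of_lowest_one (K := K) (isSl2Triple_frame he i)
    (lie_opposite_frame he hij) (by rw [lie_coroot_eq (e j).2, h']; simp)
  rw [titsElement_eq_weylOp, titsElement_eq_weylOp, hji]
  simp only [Nat.factorial_one, Nat.cast_one, inv_one, pow_one, one_smul, toEnd_apply_apply]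
  rw [← lie_skew, map_neg, hi, neg_neg]

/-- Along a simple bond the compatible root vectors change their sign relative to the frame. -/
theorem smul_rootVectors_of_simple_bond (he : ∀ i, e i ≠ 0) {k : H.root → L}
    (hk : ∀ μ, k μ ∈ rootSpace H μ.1)
    (hk' : ∀ (μ : H.root) (i : b.support), 0 < (rootSystem H).pairingIn ℤ μ i →
        k μ = titsElement L i.1 (e i : L) (k ((rootSystem H).reflectionPerm i μ)))
    {i j : b.support} (hij : i ≠ j)
    (h : (rootSystem H).pairingIn ℤ i j = -1) (h' : (rootSystem H).pairingIn ℤ j i = -1)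
    {c : K} {u : Kˣ} (hc : c • k i = u • (e i : L)) : c • k j = -u • (e j : L) := by
  -- From `α_i` to `s_j α_i` the pairing is `-1` and no sign arises; from `s_j α_i` to `α_j` it is
  -- `1` and the sign is `-1`. The frame vectors acquire no sign along the same way.
  have hpair : (rootSystem H).pairingIn ℤ ((rootSystem H).reflectionPerm j i) i = 1 := by
    rw [pairingIn_reflectionPerm_left, RootPairing.pairingIn_same, h, h']; norm_num
  have hj := titsElement_apply_rootVectors he hk hk' i j
  rw [term, if_neg (by omega), if_neg (by omega), zpow_zero, Units.val_one, one_smul] at hj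
  have hi := titsElement_apply_rootVectors he hk hk' ((rootSystem H).reflectionPerm j i) i
  rw [term, if_pos (by omega), hpair, reflectionPerm_reflectionPerm_of_simple_bond h h', zpow_one,
    Units.val_neg, Units.val_one, neg_one_smul, ← hj] at hi
  rw [← neg_neg (k j), ← hi, smul_neg, ← map_smul, ← map_smul, hc, Units.smul_def, map_smul,
    map_smul, titsElement_titsElement_frame he hij h h', Units.smul_def, Units.val_neg, neg_smul]

theorem smul_rootVectors_of_isSpecialChoice (he : ∀ i, e i ≠ 0) {k : H.root → L}
    (hk : ∀ μ, k μ ∈ rootSpace H μ.1)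
    (hk' : ∀ (μ : H.root) (i : b.support), 0 < (rootSystem H).pairingIn ℤ μ i →
        k μ = titsElement L i.1 (e i : L) (k ((rootSystem H).reflectionPerm i μ)))
    {sp : b.support → b.support} (hsp : IsSpecialChoice b sp) {c : K} {i : b.support}
    (hc : c • k (sp i) = e (sp i)) : c • k i = segmentSign b sp i • (e i : L) := by
  have hseg : SameSegment b (sp i) i :=
    ⟨(hsp.sameSegment i).1.symm, (hsp.sameSegment i).2.symm⟩
  obtain ⟨v, h0, hd, hv⟩ := hseg.exists_chain
  have key (m : ℕ) (hm : m ≤ (dynkin b).dist (sp i) i) :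
      c • k (v m) = ((-1 : Kˣ) ^ m) • (e (v m) : L) := by
    induction m with
    | zero => rw [h0, pow_zero, one_smul, hc]
    | succ m ih =>
      obtain ⟨h1, h2, h3⟩ := hv m (by omega)
      rw [smul_rootVectors_of_simple_bond he hk hk' h1 h2 h3 (ih (by omega)), pow_succ, mul_neg_one]
  have := key _ le_rfl
  rwa [hd, SimpleGraph.dist_comm] at this

/-- Replaces the lifts by an explicit rescaling of `k`, which makes existence and uniqueness
evident. The condition on special roots is the case `w = 1`. -/
theorem isKottwitzFamily_iff (he : ∀ i, e i ≠ 0) {k : H.root → L}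
    (hk : ∀ μ, k μ ∈ rootSpace H μ.1)
    (hk' : ∀ (μ : H.root) (i : b.support), 0 < (rootSystem H).pairingIn ℤ μ i →
        k μ = titsElement L i.1 (e i : L) (k ((rootSystem H).reflectionPerm i μ)))
    {sp : b.support → b.support} {c : b.support → K} (hc : ∀ i : b.support, c i • k i = e i)
    {κ : H.root → L} : IsKottwitzFamily b e sp κ ↔
      ∀ (w : (rootSystem H).weylGroup) (i : b.support),
        κ ((rootSystem H).weylGroupToPerm w (sp i)) =
          c (sp i) • k ((rootSystem H).weylGroupToPerm w (sp i)) := by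
  refine ⟨fun h w i => ?_, fun h => ⟨fun i => ?_, fun w i => ?_⟩⟩
  · rw [h.lift w i, kottwitzLift_apply_rootVectors he hk hk' w _ _ (hc (sp i))]
  · have := h 1 i
    rw [map_one] at this
    exact this.trans (hc _)
  · rw [h w i, kottwitzLift_apply_rootVectors he hk hk' w _ _ (hc (sp i))]

end Splitting

end Kottwitz

end

theorem mainTheorem4 {K L : Type*} [Field K] [CharZero K] [LieRing L] [LieAlgebra K L]
    [FiniteDimensional K L] [LieAlgebra.IsKilling K L]
    (H : LieSubalgebra K L) [H.IsCartanSubalgebra] [LieModule.IsTriangularizable K H L]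
    (b : (LieAlgebra.IsKilling.rootSystem H).Base)
    (e : ∀ i : b.support, LieAlgebra.rootSpace H i.1.1) (he : ∀ i, e i ≠ 0)
    (sp : b.support → b.support) (hsp : Kottwitz.IsSpecialChoice b sp) :
    (∃! k : H.root → L, Kottwitz.IsKottwitzFamily b e sp k) ∧
    ∀ k : H.root → L, Kottwitz.IsKottwitzFamily b e sp k →
      ∀ i : b.support,
        k i = Kottwitz.segmentSign b sp i • (e i : L) ∧
        ∀ (V : Type*) [AddCommGroup V] [Module K V] [FiniteDimensional K V]
          [LieRingModule L V] [LieModule K L V],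
          Kottwitz.titsElement V i.1 (k i) =
            Kottwitz.corootElement V i.1 (Kottwitz.segmentSign b sp i) *
              Kottwitz.titsElement V i.1 (e i : L) := by
  classical
  obtain ⟨k, hk0, hk'⟩ := Kottwitz.exists_rootVectors e he
  have hk (μ) := (hk0 μ).1
  have hex (i : b.support) : ∃ c : K, c • k i = e i :=
    Kottwitz.exists_smul_eq_of_mem_rootSpace (hk i) (hk0 i).2 (e i).2
  choose c hc using hex
  have hiff (κ : H.root → L) := Kottwitz.isKottwitzFamily_iff (sp := sp) (κ := κ) he hk hk' hc
  constructor
  · choose w j hw using fun μ => hsp.exists_weylGroup μ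
    -- Two ways of writing a root as a conjugate of a special root involve the same special root, so
    -- the scalar depends on the root only.
    refine ⟨fun μ => c (sp (j μ)) • k μ, (hiff _).mpr fun w' i => ?_, fun κ hκ => ?_⟩
    · rw [hsp.eq_of_weylGroup (hw ((LieAlgebra.IsKilling.rootSystem H).weylGroupToPerm w' (sp i)))]
    · funext μ
      have := (hiff κ).mp hκ (w μ) (j μ)
      rwa [hw μ] at this
  · intro κ hκ i
    have hκi : κ i = Kottwitz.segmentSign b sp i • (e i : L) := by
      have hseg : Kottwitz.SameSegment b (sp i) i :=
        ⟨(hsp.sameSegment i).1.symm, (hsp.sameSegment i).2.symm⟩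
      obtain ⟨w, hw⟩ := hseg.exists_weylGroup
      have := (hiff κ).mp hκ w i
      rw [hw] at this
      rw [this, Kottwitz.smul_rootVectors_of_isSpecialChoice he hk hk' hsp (hc (sp i))]
    refine ⟨hκi, fun V _ _ _ _ _ => ?_⟩
    have he0 := Kottwitz.coe_ne_zero (he i)
    rw [hκi, Kottwitz.segmentSign]
    rcases neg_one_pow_eq_or Kˣ ((Kottwitz.dynkin b).dist i (sp i)) with h | h
    · rw [h, one_smul, Kottwitz.corootElement_one (e i).2 he0, one_mul]
    · rw [h, Units.smul_def, Units.val_neg, Units.val_one, neg_one_smul]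
      exact Kottwitz.titsElement_neg (e i).2 he0
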